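/- Conventions. All rings are commutative with $1$; $\mathbb{N}=\{1,2,\dots\}$. Let $P_k(s_1,\dots,s_k;\sigma_1,\dots,\sigma_k)$ be the coefficient of $t^k$ in $\prod_{i,j}(1+\xi_i\eta_jt)$, written as an integral polynomial in the elementary symmetric functions $s_a$ of the $\xi_i$ and $\sigma_b$ of the $\eta_j$, and let $P_{k,l}(s_1,\dots,s_{kl})$ be the coefficient of $t^k$ in $\prod_{i_1<\dots<i_l}(1+\xi_{i_1}\cdots\xi_{i_l}t)$, written in the elementary symmetric functions $s_a$ of the $\xi_i$ (with sufficiently many indeterminates). A $\lambda$-ring is a ring $R$ with maps $\lambda^i:R\to R$, $i\ge 0$, such that for all $r,s\in R$ and $i,j\ge0$: $\lambda^0(r)=1$, $\lambda^1(r)=r$, $\lambda^i(r+s)=\sum_{k=0}^i\lambda^k(r)\lambda^{i-k}(s)$, $\sum_{k\ge0}\lambda^k(1)t^k=1+t$, $\lambda^i(rs)=P_i(\lambda^1(r),\dots,\lambda^i(r);\lambda^1(s),\dots,\lambda^i(s))$ and $\lambda^i(\lambda^j(r))=P_{i,j}(\lambda^1(r),\dots,\lambda^{ij}(r))$. Its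 Adams operations $\Psi^i:R\to R$, $i\in\mathbb{N}$, are defined by $$\Psi^i(r)-\lambda^1(r)\Psi^{i-1}(r)+\dots+(-1)^{i-1}\lambda^{i-1}(r)\Psi^1(r)+(-1)^i\,i\,\lambda^i(r)=0 .$$ A $\Psi$-ring is a ring with ring endomorphisms $\Psi^i$, $i\in\mathbb{N}$, such that $\Psi^1=\mathrm{id}$ and $\Psi^i\Psi^j=\Psi^{ij}$. A $\Psi$-module over a $\Psi$-ring $R$ is an $R$-module with additive maps $\psi^i$, $i\in\mathbb{N}$, such that $\psi^1=\mathrm{id}$, $\psi^i(rm)=\Psi^i(r)\psi^i(m)$ and $\psi^i\psi^j=\psi^{ij}$. A $\lambda$-module over a $\lambda$-ring $R$ is an $R$-module $M$ with additive maps $\Lambda^i:M\to M$, $i\in\mathbb{N}$, such that $\Lambda^1=\mathrm{id}$, $\Lambda^i(rm)=\Psi^i(r)\Lambda^i(m)$ and $\Lambda^{ij}(m)=(-1)^{(i+1)(j+1)}\Lambda^i\Lambda^j(m)$ for all $r\in R$, $m\in M$, $i,j\in\mathbb{N}$. For an $R$-module $M$ let $R\rtimes M$ be the set $R\times M$ with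 the ring structure $(r,m)+(s,n)=(r+s,m+n)$, $(r,m)(s,n)=(rs,rn+ms)$. Lemma. Let $R$ be a $\lambda$-ring and $M$ a $\lambda$-module over $R$. (1) The ring $R\rtimes M$ with the operations $\lambda^0(r,m)=(1,0)$ and $$\lambda^i(r,m)=\Bigl(\lambda^i(r),\ \sum_{j=1}^i\Lambda^j(m)\lambda^{i-j}(r)\Bigr)\qquad(i\in\mathbb{N})$$ is a $\lambda$-ring, denoted $R\rtimes_\lambda M$. (2) Let $R_\Psi$ be $R$ with its Adams operations $\Psi^i$, and let $M_\Psi$ be $M$ with the maps $\psi^i(m)=(-1)^{i+1}\,i\,\Lambda^i(m)$. Then $R_\Psi$ is a $\Psi$-ring, $M_\Psi$ is a $\Psi$-module over $R_\Psi$, and $R\rtimes M$ with $(r,m)\mapsto(\Psi^i(r),\psi^i(m))$, $i\in\mathbb{N}$, is a $\Psi$-ring, denoted $R_\Psi\rtimes_\Psi M_\Psi$. It is the $\Psi$-ring associated with $R\rtimes_\lambda M$: $(R\rtimes_\lambda M)_\Psi=R_\Psi\rtimes_\Psi M_\Psi$, that is, the $i$-th Adams operation of $R\rtimes_\lambda M$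 is $(r,m)\mapsto(\Psi^i(r),\psi^i(m))$ for all $i\in\mathbb{N}$. -/

import Mathlib

namespace LambdaPsi

open MvPolynomial

/-! ### The universal polynomials -/

/-- The coefficient of `t ^ k` in `∏_{i, j} (1 + ξ_i η_j t)`, with indeterminates
`ξ_i = X (inl i)` for `1 ≤ i ≤ q` and `η_j = X (inr j)` for `1 ≤ j ≤ r`. -/
noncomputable def prodCoeff (q r k : ℕ) : MvPolynomial (Fin q ⊕ Fin r) ℤ :=
  (∏ i : Fin q, ∏ j : Fin r,
    (1 + Polynomial.C (X (Sum.inl i) * X (Sum.inr j)) * Polynomial.X)).coeff k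

/-- The coefficient of `t ^ k` in `∏_{i_1 < ... < i_l} (1 + ξ_{i_1} ... ξ_{i_l} t)`, with
indeterminates `ξ_i = X i` for `1 ≤ i ≤ q`. -/
noncomputable def compCoeff (q k l : ℕ) : MvPolynomial (Fin q) ℤ :=
  (∏ s ∈ Finset.powersetCard l (Finset.univ : Finset (Fin q)),
    (1 + Polynomial.C (∏ i ∈ s, X i) * Polynomial.X)).coeff k

/-- The elementary symmetric polynomials `s_1, ..., s_k` of the `ξ`'s (on the `inl` summand) and
`σ_1, ..., σ_k` of the `η`'s (on the `inr` summand). -/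
noncomputable def esymmPair (q r k : ℕ) : Fin k ⊕ Fin k → MvPolynomial (Fin q ⊕ Fin r) ℤ :=
  Sum.elim (fun i => rename Sum.inl (esymm (Fin q) ℤ (i + 1)))
    (fun i => rename Sum.inr (esymm (Fin r) ℤ (i + 1)))

/-- Substituting elementary symmetric polynomials in both groups of variables, written through
the identification `ℤ[ξ, η] = ℤ[η][ξ]`. -/
theorem aeval_esymmPair (k : ℕ) (p : MvPolynomial (Fin k ⊕ Fin k) ℤ) :
    sumAlgEquiv ℤ (Fin k) (Fin k) (aeval (esymmPair k k k) p) =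
      (esymmAlgHom (Fin k) (MvPolynomial (Fin k) ℤ) k
        (MvPolynomial.map (aeval (fun i : Fin k => esymm (Fin k) ℤ (i + 1)) :
          MvPolynomial (Fin k) ℤ →ₐ[ℤ] MvPolynomial (Fin k) ℤ).toRingHom
          (sumAlgEquiv ℤ (Fin k) (Fin k) p))).val := by
  rw [esymmAlgHom_apply]
  induction p using MvPolynomial.induction_on with
  | C a => simp [sumAlgEquiv]
  | add p q hp hq => simp only [map_add, hp, hq]
  | mul_X p i hp =>
    simp only [map_mul, hp]
    congr 1
    rcases i with i | i
    · simp [esymmPair, esymm, map_sum, map_prod]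
    · simp [esymmPair, esymm, map_sum, map_prod]

theorem map_aeval_esymm {A : Type*} [CommRing A] (k : ℕ) (g : A →+* A) (p : MvPolynomial (Fin k) A) :
    MvPolynomial.map g (aeval (fun i : Fin k => esymm (Fin k) A (i + 1)) p) =
      aeval (fun i : Fin k => esymm (Fin k) A (i + 1)) (MvPolynomial.map g p) := by
  induction p using MvPolynomial.induction_on with
  | C a => simp
  | add p q hp hq => simp only [map_add, hp, hq]
  | mul_X p i hp => rw [map_mul, map_mul, map_mul, map_mul, hp, aeval_X, map_X, aeval_X, map_esymm]

/-- Existence and uniqueness of the polynomial that expresses the coefficient of `t ^ k` in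
`∏_{i, j} (1 + ξ_i η_j t)` through elementary symmetric polynomials. -/
theorem existsUnique_prodPoly (k : ℕ) :
    ∃! p : MvPolynomial (Fin k ⊕ Fin k) ℤ, aeval (esymmPair k k k) p = prodCoeff k k k := by
  set f : MvPolynomial (Fin k) ℤ →ₐ[ℤ] MvPolynomial (Fin k) ℤ :=
    aeval (fun i : Fin k => esymm (Fin k) ℤ (i + 1)) with hf
  have hfinj : Function.Injective f := by
    intro a b hab
    apply esymmAlgHom_injective (σ := Fin k) (n := k) ℤ (by simp)
    apply Subtype.ext
    rw [esymmAlgHom_apply, esymmAlgHom_apply]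
    exact hab
  have hEinj : Function.Injective (esymmAlgHom (Fin k) (MvPolynomial (Fin k) ℤ) k) :=
    esymmAlgHom_injective _ (by simp)
  have hEsurj : Function.Surjective (esymmAlgHom (Fin k) (MvPolynomial (Fin k) ℤ) k) :=
    esymmAlgHom_surjective _ (by simp)
  have hinj : Function.Injective
      (fun p : MvPolynomial (Fin k ⊕ Fin k) ℤ => aeval (esymmPair k k k) p) := by
    intro a b hab
    have h := congrArg (sumAlgEquiv ℤ (Fin k) (Fin k)) hab
    simp only [aeval_esymmPair] at h
    exact (sumAlgEquiv ℤ (Fin k) (Fin k)).injective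
      (MvPolynomial.map_injective _ hfinj (hEinj (Subtype.ext h)))
  have hσ : ∀ m : ℕ, ∃ a : MvPolynomial (Fin k) ℤ, f a = esymm (Fin k) ℤ m := by
    intro m
    obtain ⟨a, ha⟩ := esymmAlgHom_surjective (σ := Fin k) (n := k) ℤ (by simp)
      ⟨esymm (Fin k) ℤ m, esymm_isSymmetric _ _ _⟩
    refine ⟨a, ?_⟩
    have := congrArg Subtype.val ha
    rwa [esymmAlgHom_apply] at this
  choose σ' hσ' using hσ
  set G : Polynomial (MvPolynomial (Fin k) (MvPolynomial (Fin k) ℤ)) :=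
    ∏ i : Fin k, ∑ m ∈ Finset.range (k + 1),
      Polynomial.C (C (σ' m) * X i ^ m) * Polynomial.X ^ m with hG
  have hGsymm : (G.coeff k).IsSymmetric := by
    intro e
    have h : rename e (G.coeff k) = (G.map
        (rename e : MvPolynomial (Fin k) (MvPolynomial (Fin k) ℤ) →ₐ[_] _).toRingHom).coeff k := by
      simp
    rw [h, hG, Polynomial.map_prod]
    congr 1
    refine Fintype.prod_equiv e _ _ ?_
    intro i
    simp [Polynomial.map_sum]
  have hGmap : G.map (MvPolynomial.map f.toRingHom) =
      (∏ i : Fin k, ∏ j : Fin k, (1 + Polynomial.C (X (Sum.inl i) * X (Sum.inr j)) *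
        Polynomial.X)).map (sumAlgEquiv ℤ (Fin k) (Fin k)).toAlgHom.toRingHom := by
    rw [hG, Polynomial.map_prod, Polynomial.map_prod]
    refine Finset.prod_congr rfl fun i _ => ?_
    rw [Polynomial.map_prod, Polynomial.map_sum]
    have h1 : ∀ j : Fin k, Polynomial.map (sumAlgEquiv ℤ (Fin k) (Fin k)).toAlgHom.toRingHom
        (1 + Polynomial.C (X (Sum.inl i) * X (Sum.inr j)) * Polynomial.X) =
        1 + Polynomial.C (X i * C (X j)) * Polynomial.X := by
      intro j; simp
    simp_rw [h1]
    rw [Finset.prod_one_add, Finset.sum_powerset]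
    simp only [Finset.card_univ, Fintype.card_fin]
    refine Finset.sum_congr rfl fun m _ => ?_
    have h2 : f.toRingHom (σ' m) = esymm (Fin k) ℤ m := hσ' m
    rw [Polynomial.map_mul, Polynomial.map_C, map_mul, map_C, h2, esymm, map_sum,
      Finset.sum_mul, map_sum, Polynomial.map_pow, Polynomial.map_X, Finset.sum_mul]
    refine Finset.sum_congr rfl fun s hs => ?_
    rw [Finset.mem_powersetCard] at hs
    rw [Finset.prod_mul_distrib, Finset.prod_const, hs.2, ← map_prod, Finset.prod_mul_distrib,
      Finset.prod_const, hs.2, map_prod, map_pow, map_X, mul_comm (X i ^ m)]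
  obtain ⟨p0, hp0⟩ := hEsurj ⟨G.coeff k, hGsymm⟩
  have hp0' := congrArg Subtype.val hp0
  rw [esymmAlgHom_apply] at hp0'
  have hex : aeval (esymmPair k k k) ((sumAlgEquiv ℤ (Fin k) (Fin k)).symm p0) =
      prodCoeff k k k := by
    apply (sumAlgEquiv ℤ (Fin k) (Fin k)).injective
    rw [aeval_esymmPair, AlgEquiv.apply_symm_apply, esymmAlgHom_apply]
    have h3 : (sumAlgEquiv ℤ (Fin k) (Fin k)) (prodCoeff k k k) =
        (G.map (MvPolynomial.map f.toRingHom)).coeff k := by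
      rw [hGmap, prodCoeff]; simp
    rw [h3, Polynomial.coeff_map, ← show _ = G.coeff k from hp0']
    rw [← hf]
    exact (map_aeval_esymm _ _ _).symm
  exact ⟨_, hex, fun p' hp' => hinj (hp'.trans hex.symm)⟩

theorem compCoeff_isSymmetric (q k l : ℕ) : (compCoeff q k l).IsSymmetric := by
  intro e
  have h : ∀ (F : Polynomial (MvPolynomial (Fin q) ℤ)),
      rename e (F.coeff k) =
        (F.map (rename e : MvPolynomial (Fin q) ℤ →ₐ[ℤ] _).toRingHom).coeff k := by
    intro F; simp
  rw [compCoeff, h, Polynomial.map_prod]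
  congr 1
  refine Finset.prod_bij (fun s _ => s.map e.toEmbedding) ?_ ?_ ?_ ?_
  · intro s hs
    simpa [Finset.mem_powersetCard] using hs
  · intro s _ t _ hst
    simpa using hst
  · intro s hs
    refine ⟨s.map e.symm.toEmbedding, ?_, ?_⟩
    · simpa [Finset.mem_powersetCard] using hs
    · ext x; simp
  · intro s _
    simp [Polynomial.map_prod, Polynomial.map_add, Polynomial.map_mul, Finset.prod_map]

/-- Existence and uniqueness of the polynomial that expresses the coefficient of `t ^ k` in
`∏_{i_1 < ... < i_l} (1 + ξ_{i_1} ... ξ_{i_l} t)` through elementary symmetric polynomials. -/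
theorem existsUnique_compPoly (k l : ℕ) :
    ∃! p : MvPolynomial (Fin (k * l)) ℤ,
      aeval (fun i : Fin (k * l) => esymm (Fin (k * l)) ℤ (i + 1)) p = compCoeff (k * l) k l := by
  have hb : Function.Bijective (esymmAlgHom (Fin (k * l)) ℤ (k * l)) :=
    ⟨esymmAlgHom_injective ℤ (by simp), esymmAlgHom_surjective ℤ (by simp)⟩
  obtain ⟨p, hp⟩ := hb.2 ⟨compCoeff (k * l) k l, compCoeff_isSymmetric _ _ _⟩
  refine ⟨p, ?_, ?_⟩
  · have := congrArg Subtype.val hp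
    rwa [esymmAlgHom_apply] at this
  · intro p' hp'
    apply hb.1
    rw [hp]
    apply Subtype.ext
    rw [esymmAlgHom_apply]
    exact hp'

/-- The universal polynomial `P_k(s_1, ..., s_k; σ_1, ..., σ_k)`: the coefficient of `t ^ k` in
`∏_{i, j} (1 + ξ_i η_j t)`, as a polynomial in the elementary symmetric functions. The variable
`inl i` stands for `s_{i+1}` and `inr i` for `σ_{i+1}`; `k` indeterminates of each kind suffice. -/
noncomputable def prodPoly (k : ℕ) : MvPolynomial (Fin k ⊕ Fin k) ℤ :=
  (existsUnique_prodPoly k).choose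

theorem prodPoly_spec (k : ℕ) : aeval (esymmPair k k k) (prodPoly k) = prodCoeff k k k :=
  (existsUnique_prodPoly k).choose_spec.1

/-- The universal polynomial `P_{k,l}(s_1, ..., s_{kl})`: the coefficient of `t ^ k` in
`∏_{i_1 < ... < i_l} (1 + ξ_{i_1} ... ξ_{i_l} t)`, as a polynomial in the elementary symmetric
functions. The variable `i` stands for `s_{i+1}`; `k * l` indeterminates `ξ` suffice. -/
noncomputable def compPoly (k l : ℕ) : MvPolynomial (Fin (k * l)) ℤ :=
  (existsUnique_compPoly k l).choose

theorem compPoly_spec (k l : ℕ) :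
    aeval (fun i : Fin (k * l) => esymm (Fin (k * l)) ℤ (i + 1)) (compPoly k l) =
      compCoeff (k * l) k l :=
  (existsUnique_compPoly k l).choose_spec.1

/-! ### Rings with operations -/

/-- The operations `lam i = λ^i`, `i ≥ 0`, make the commutative ring `R` a pre-λ-ring. -/
structure IsPreLambdaRing {R : Type*} [CommRing R] (lam : ℕ → R → R) : Prop where
  lam_zero : ∀ r, lam 0 r = 1
  lam_one : ∀ r, lam 1 r = r
  lam_add : ∀ i r s, lam i (r + s) = ∑ k ∈ Finset.range (i + 1), lam k r * lam (i - k) s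

/-- The operations `lam i = λ^i`, `i ≥ 0`, make the commutative ring `R` a λ-ring. -/
structure IsLambdaRing {R : Type*} [CommRing R] (lam : ℕ → R → R) : Prop
    extends IsPreLambdaRing lam where
  /-- `λ_t(1) = 1 + t` -/
  lamSeries_one : PowerSeries.mk (fun i => lam i 1) = 1 + PowerSeries.X
  /-- `λ^i(rs) = P_i(λ^1(r), ..., λ^i(r), λ^1(s), ..., λ^i(s))` -/
  lam_mul : ∀ i r s, lam i (r * s) =
    aeval (Sum.elim (fun k : Fin i => lam (k + 1) r) (fun k : Fin i => lam (k + 1) s)) (prodPoly i)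
  /-- `λ^i(λ^j(r)) = P_{i,j}(λ^1(r), ..., λ^{ij}(r))` -/
  lam_lam : ∀ i j r, lam i (lam j r) =
    aeval (fun k : Fin (i * j) => lam (k + 1) r) (compPoly i j)

/-- The Adams operations `Ψ^i`, `i ≥ 1`, of a family of operations `λ^i`, given recursively by the
Newton formula (see `adams_newton`). The value at `i = 0` is not used. -/
def adams {R : Type*} [CommRing R] (lam : ℕ → R → R) : ℕ → R → R
  | 0, _ => 0
  | n + 1, r => (∑ j : Fin n, (-1) ^ (j : ℕ) * lam (j + 1) r * adams lam (n - j) r) +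
      (-1) ^ n * ((n + 1 : ℕ) : R) * lam (n + 1) r

/-- `Ψ^i(r) - λ^1(r)Ψ^{i-1}(r) + ... + (-1)^{i-1}λ^{i-1}(r)Ψ^1(r) + (-1)^i i λ^i(r) = 0` -/
theorem adams_newton {R : Type*} [CommRing R] (lam : ℕ → R → R) (i : ℕ) (hi : 0 < i) (r : R) :
    adams lam i r + ∑ j ∈ Finset.Icc 1 (i - 1), (-1) ^ j * lam j r * adams lam (i - j) r +
      (-1) ^ i * (i : R) * lam i r = 0 := by
  obtain ⟨n, rfl⟩ : ∃ n, i = n + 1 := ⟨i - 1, by omega⟩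
  have h : ∑ j ∈ Finset.Icc 1 (n + 1 - 1), (-1) ^ j * lam j r * adams lam (n + 1 - j) r =
      -∑ j : Fin n, (-1) ^ (j : ℕ) * lam (j + 1) r * adams lam (n - j) r := by
    rw [Fin.sum_univ_eq_sum_range (fun j => (-1) ^ j * lam (j + 1) r * adams lam (n - j) r),
      ← Finset.sum_neg_distrib, ← Finset.Ico_succ_right_eq_Icc, Finset.sum_Ico_eq_sum_range]
    refine Finset.sum_congr (by simp) fun j _ => ?_
    rw [add_comm 1 j, pow_succ, Nat.add_sub_add_right]
    ring
  rw [h, adams, pow_succ]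
  ring

/-- The maps `psi i = Ψ^i`, `i ≥ 1`, make the commutative ring `R` a Ψ-ring: they are ring
homomorphisms with `Ψ^1 = id` and `Ψ^i Ψ^j = Ψ^{ij}`. The map `psi 0` is irrelevant. -/
structure IsPsiRing {R : Type*} [CommRing R] (psi : ℕ → R → R) : Prop where
  map_one : ∀ i, 0 < i → psi i 1 = 1
  map_add : ∀ i, 0 < i → ∀ r s, psi i (r + s) = psi i r + psi i s
  map_mul : ∀ i, 0 < i → ∀ r s, psi i (r * s) = psi i r * psi i s
  psi_one : ∀ r, psi 1 r = r
  psi_psi : ∀ i j, 0 < i → 0 < j → ∀ r, psi i (psi j r) = psi (i * j) r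

/-! ### Modules with operations -/

/-- The maps `psiM i = ψ^i`, `i ≥ 1`, make the `R`-module `M` a Ψ-module over `(R, psi)`. -/
structure IsPsiModule {R M : Type*} [CommRing R] [AddCommGroup M] [Module R M]
    (psi : ℕ → R → R) (psiM : ℕ → M → M) : Prop where
  map_add : ∀ i, 0 < i → ∀ m n, psiM i (m + n) = psiM i m + psiM i n
  psi_one : ∀ m, psiM 1 m = m
  psi_smul : ∀ i, 0 < i → ∀ (r : R) (m : M), psiM i (r • m) = psi i r • psiM i m
  psi_psi : ∀ i j, 0 < i → 0 < j → ∀ m, psiM i (psiM j m) = psiM (i * j) m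

/-- The maps `Lam i = Λ^i`, `i ≥ 1`, make the `R`-module `M` a λ-module over `(R, lam)`. -/
structure IsLambdaModule {R M : Type*} [CommRing R] [AddCommGroup M] [Module R M]
    (lam : ℕ → R → R) (Lam : ℕ → M → M) : Prop where
  map_add : ∀ i, 0 < i → ∀ m n, Lam i (m + n) = Lam i m + Lam i n
  Lam_one : ∀ m, Lam 1 m = m
  Lam_smul : ∀ i, 0 < i → ∀ (r : R) (m : M), Lam i (r • m) = adams lam i r • Lam i m
  Lam_mul : ∀ i j, 0 < i → 0 < j → ∀ m,
    Lam (i * j) m = ((-1 : ℤ) ^ ((i + 1) * (j + 1))) • Lam i (Lam j m)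

/-- The Adams operations `ψ^n(m) = (-1)^{n+1} n Λ^n(m)` of a λ-module. -/
def adamsModule {M : Type*} [AddCommGroup M] (Lam : ℕ → M → M) (n : ℕ) (m : M) : M :=
  ((-1 : ℤ) ^ (n + 1) * (n : ℤ)) • Lam n m

/-! ### Semi-direct products

The underlying ring of `R ⋊ M` is `TrivSqZeroExt R M`: pairs `(r, m)` with componentwise addition
and `(r, m)(s, n) = (rs, rn + ms)`. -/

/-- The operations `λ^0(r, m) = (1, 0)` and, for `i ≥ 1`,
`λ^i(r, m) = (λ^i(r), ∑_{j=1}^i Λ^j(m) λ^{i-j}(r))` on `R ⋊ M`. -/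
def semidirectLam {R M : Type*} [CommRing R] [AddCommGroup M] [Module R M]
    (lam : ℕ → R → R) (Lam : ℕ → M → M) (i : ℕ) (x : TrivSqZeroExt R M) : TrivSqZeroExt R M :=
  if i = 0 then 1 else
    TrivSqZeroExt.inl (lam i x.fst) +
      TrivSqZeroExt.inr (∑ j ∈ Finset.Icc 1 i, lam (i - j) x.fst • Lam j x.snd)

/-- The operations `Ψ^i(r, m) = (Ψ^i(r), ψ^i(m))` of `R ⋊_Ψ M`. -/
def semidirectPsi {R M : Type*} [CommRing R] [AddCommGroup M]
    (psi : ℕ → R → R) (psiM : ℕ → M → M) (i : ℕ) (x : TrivSqZeroExt R M) : TrivSqZeroExt R M :=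
  TrivSqZeroExt.inl (psi i x.fst) + TrivSqZeroExt.inr (psiM i x.snd)

end LambdaPsi

/-! The proof is a splitting principle. In a suitable extension ring, the values `λ^1(r), ...,
λ^N(r)` become the elementary symmetric functions of a finite multiset `s` of formal roots
(`exists_roots`). The λ-ring axioms then say that a sum corresponds to the union of multisets, a
product to `mulRoots`, `λ^l` to `extRoots l`, and by Newton's identities `Ψ^n(r)` is the power sum
of `s`. This rests on evaluating `P_k` and `P_{k,l}` at multisets of arbitrary size
(`aeval_prodPoly`, `aeval_compPoly`). That the Adams operations form a Ψ-ring is then a statement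
about power sums.

An element `m` of `M` likewise gets a multiset `t` with elementary symmetric functions `Λ^k(m)`.
These lie in a square-zero ideal, so all products `e_a(t) e_b(t)` with `a, b > 0` vanish (`IsNull`).
For such `t`, `p_n(t) = (-1)^(n+1) n e_n(t)`, `e_k(s·t) = p_k(s) e_k(t)`, and `e_k(extRoots l t) =
(-1)^((k+1)(l+1)) e_{kl}(t)`. The last two match the λ-module axioms for `Λ^k(rm)` and `Λ^{kl}`; the
first is the definition of `ψ^n`. They are `IsNull.powerSum_eq`, `IsNull.esymm_mulRoots` and
`IsNull.esymm_extRoots`.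

The formula for `λ^i(r, m)` says exactly that `(r, m)` has roots `s + t`. Each λ-ring axiom for `R ⋊
M` becomes the decomposition of a sum, product or exterior power of such unions, and the Adams
operations are read off from `p_i(s + t) = p_i(s) + p_i(t)`. -/

namespace LambdaPsi

open Polynomial

/-! ### Elementary symmetric functions and power sums of multisets -/

section Roots

variable {A B : Type*} [CommRing A] [CommRing B]

/-- The polynomial `∏ (1 + ξ t)`, where `ξ` runs through the multiset `s`. -/
noncomputable def rootPoly (s : Multiset A) : A[X] := (s.map fun x => 1 + C x * X).prod

/-- The sum of the `k`-th powers of the elements of `s`. -/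
def powerSum (s : Multiset A) (k : ℕ) : A := (s.map (· ^ k)).sum

/-- The multiset of the products `ξ η`. -/
def mulRoots (s t : Multiset A) : Multiset A := (s ×ˢ t).map fun p => p.1 * p.2

/-- The multiset of the products `ξ_{i_1} ... ξ_{i_l}` with `i_1 < ... < i_l`. -/
def extRoots (l : ℕ) (s : Multiset A) : Multiset A := (s.powersetCard l).map Multiset.prod

theorem esymm_zero (s : Multiset A) : s.esymm 0 = 1 := by
  simp [Multiset.esymm]

theorem esymm_one (s : Multiset A) : s.esymm 1 = s.sum := by
  simp [Multiset.esymm, Multiset.powersetCard_one]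

theorem zero_esymm_succ (k : ℕ) : (0 : Multiset A).esymm (k + 1) = 0 := by
  simp [Multiset.esymm, Multiset.powersetCard_zero_right]

theorem cons_esymm_succ (a : A) (s : Multiset A) (k : ℕ) :
    (a ::ₘ s).esymm (k + 1) = s.esymm (k + 1) + a * s.esymm k := by
  simp [Multiset.esymm, Multiset.powersetCard_cons, Multiset.sum_map_mul_left]

theorem esymm_eq_zero_of_card_lt (s : Multiset A) {k : ℕ} (h : s.card < k) : s.esymm k = 0 := by
  simp [Multiset.esymm, Multiset.powersetCard_eq_empty _ h]

theorem map_esymm (f : A →+* B) (s : Multiset A) (k : ℕ) :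
    (s.map f).esymm k = f (s.esymm k) := by
  simp [Multiset.esymm, Multiset.powersetCard_map, Multiset.map_map, map_multiset_sum,
    map_multiset_prod]

theorem map_mulRoots (f : A →+* B) (s t : Multiset A) :
    (mulRoots s t).map f = mulRoots (s.map f) (t.map f) := by
  induction s using Multiset.induction_on with
  | empty => simp [mulRoots]
  | cons a s ih =>
    simp only [mulRoots, Multiset.map_map] at ih
    simp [mulRoots, Multiset.map_map, ← ih]

theorem map_extRoots (f : A →+* B) (l : ℕ) (s : Multiset A) :
    (extRoots l s).map f = extRoots l (s.map f) := by
  simp [extRoots, Multiset.powersetCard_map, Multiset.map_map, map_multiset_prod]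

theorem rootPoly_zero : rootPoly (0 : Multiset A) = 1 := by simp [rootPoly]

theorem rootPoly_cons (a : A) (s : Multiset A) :
    rootPoly (a ::ₘ s) = (1 + C a * X) * rootPoly s := by simp [rootPoly]

theorem rootPoly_add (s t : Multiset A) : rootPoly (s + t) = rootPoly s * rootPoly t := by
  simp [rootPoly]

theorem coeff_rootPoly (s : Multiset A) (k : ℕ) : (rootPoly s).coeff k = s.esymm k := by
  induction s using Multiset.induction_on generalizing k with
  | empty =>
    rcases k with _ | k
    · simp [rootPoly_zero, esymm_zero]
    · simp [rootPoly_zero, zero_esymm_succ, coeff_one]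
  | cons a s ih =>
    rw [rootPoly_cons, add_mul, one_mul, coeff_add, mul_assoc, coeff_C_mul]
    rcases k with _ | k
    · simp [ih, esymm_zero]
    · rw [coeff_X_mul, ih, ih, cons_esymm_succ]

theorem esymm_add (s t : Multiset A) (k : ℕ) :
    (s + t).esymm k = ∑ j ∈ Finset.range (k + 1), s.esymm j * t.esymm (k - j) := by
  simp only [← coeff_rootPoly, rootPoly_add, coeff_mul]
  rw [Finset.Nat.sum_antidiagonal_eq_sum_range_succ
    (fun a b => (rootPoly s).coeff a * (rootPoly t).coeff b)]

theorem powerSum_add (s t : Multiset A) (k : ℕ) :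
    powerSum (s + t) k = powerSum s k + powerSum t k := by simp [powerSum]

theorem powerSum_cons (a : A) (s : Multiset A) (k : ℕ) :
    powerSum (a ::ₘ s) k = a ^ k + powerSum s k := by simp [powerSum]

theorem powerSum_map_pow (s : Multiset A) (i k : ℕ) :
    powerSum (s.map (· ^ i)) k = powerSum s (i * k) := by
  simp [powerSum, pow_mul]

theorem zero_mulRoots (t : Multiset A) : mulRoots 0 t = 0 := by simp [mulRoots]

theorem cons_mulRoots (a : A) (s t : Multiset A) :
    mulRoots (a ::ₘ s) t = t.map (a * ·) + mulRoots s t := by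
  simp [mulRoots, Multiset.map_map]

theorem add_mulRoots (s s' t : Multiset A) :
    mulRoots (s + s') t = mulRoots s t + mulRoots s' t := by
  simp [mulRoots, Multiset.add_product]

theorem mulRoots_add (s t t' : Multiset A) :
    mulRoots s (t + t') = mulRoots s t + mulRoots s t' := by
  simp [mulRoots, Multiset.product_add]

theorem mulRoots_zero (s : Multiset A) : mulRoots s 0 = 0 := by simp [mulRoots]

theorem singleton_mulRoots (a : A) (t : Multiset A) : mulRoots {a} t = t.map (a * ·) := by
  rw [← Multiset.cons_zero, cons_mulRoots, zero_mulRoots, add_zero]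

theorem mulRoots_singleton (s : Multiset A) (a : A) : mulRoots s {a} = s.map (a * ·) := by
  induction s using Multiset.induction_on with
  | empty => simp [mulRoots]
  | cons b s ih =>
    rw [cons_mulRoots, ih]
    simp [mul_comm]

theorem mulRoots_comm (s t : Multiset A) : mulRoots s t = mulRoots t s := by
  induction s using Multiset.induction_on with
  | empty => rw [zero_mulRoots, mulRoots_zero]
  | cons a s ih =>
    rw [← Multiset.singleton_add, add_mulRoots, mulRoots_add, ih, singleton_mulRoots,
      mulRoots_singleton]

theorem powerSum_mulRoots (s t : Multiset A) (k : ℕ) :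
    powerSum (mulRoots s t) k = powerSum s k * powerSum t k := by
  induction s using Multiset.induction_on with
  | empty => simp [powerSum, mulRoots]
  | cons a s ih =>
    rw [cons_mulRoots, powerSum_add, ih, powerSum_cons, add_mul]
    simp [powerSum, mul_pow, Multiset.sum_map_mul_left]

/-- Both sides sum the `k`-th powers of the products over `l`-element subfamilies. This exchange of
the two operations gives `Ψ^i Ψ^j = Ψ^{ij}` and controls the power sums of `extRoots`. -/
theorem map_pow_esymm (s : Multiset A) (k l : ℕ) :
    (s.map (· ^ k)).esymm l = powerSum (extRoots l s) k := by
  simp [powerSum, extRoots, Multiset.esymm, Multiset.powersetCard_map, Multiset.map_map,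
    Multiset.prod_map_pow]

theorem extRoots_zero (s : Multiset A) : extRoots 0 s = {1} := by simp [extRoots]

theorem extRoots_cons_succ (a : A) (s : Multiset A) (l : ℕ) :
    extRoots (l + 1) (a ::ₘ s) = extRoots (l + 1) s + (extRoots l s).map (a * ·) := by
  simp [extRoots, Multiset.powersetCard_cons, Multiset.map_map]

theorem map_mul_mulRoots (a : A) (s t : Multiset A) :
    (mulRoots s t).map (a * ·) = mulRoots (s.map (a * ·)) t := by
  induction s using Multiset.induction_on with
  | empty => simp [mulRoots]
  | cons b s ih =>
    rw [Multiset.map_cons, cons_mulRoots, cons_mulRoots, Multiset.map_add, ih]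
    simp [Multiset.map_map, mul_assoc]

/-- Every `l`-element subfamily of a union splits into a part from each side. The induction on `s`
is Pascal's rule: a subfamily contains the new element or omits it. -/
theorem extRoots_add (s t : Multiset A) (l : ℕ) :
    extRoots l (s + t) =
      ∑ j ∈ Finset.range (l + 1), mulRoots (extRoots (l - j) s) (extRoots j t) := by
  induction s using Multiset.induction_on generalizing l with
  | empty =>
    rw [Finset.sum_range_succ, Finset.sum_eq_zero]
    · simp [extRoots_zero, singleton_mulRoots]
    · intro j hj
      obtain ⟨d, hd⟩ : ∃ d, l - j = d + 1 := ⟨l - j - 1, by have := Finset.mem_range.1 hj; omega⟩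
      rw [hd]
      simp [extRoots, Multiset.powersetCard_zero_right, zero_mulRoots]
  | cons a s ih =>
    rcases l with _ | l
    · simp [extRoots_zero, mulRoots]
    -- The term `j = l + 1` takes nothing from the first family, so Pascal's rule does not apply to
    -- it; it is split off and agrees on both sides.
    · rw [Multiset.cons_add, extRoots_cons_succ, ih, ih, Finset.sum_range_succ,
        Finset.sum_range_succ _ (l + 1), ← Multiset.coe_mapAddMonoidHom, map_sum]
      have h : ∀ j ∈ Finset.range (l + 1),
          mulRoots (extRoots (l + 1 - j) (a ::ₘ s)) (extRoots j t) =
          mulRoots (extRoots (l + 1 - j) s) (extRoots j t) +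
            (mulRoots (extRoots (l - j) s) (extRoots j t)).map (a * ·) := by
        intro j hj
        rw [Nat.succ_sub (by have := Finset.mem_range.1 hj; omega), extRoots_cons_succ,
          add_mulRoots, map_mul_mulRoots]
      rw [Finset.sum_congr rfl h, Finset.sum_add_distrib]
      simp only [Nat.sub_self, extRoots_zero]
      abel

/-- Newton's identities. -/
theorem powerSum_newton (s : Multiset A) (n : ℕ) :
    powerSum s (n + 1) =
      (∑ j : Fin n, (-1) ^ (j : ℕ) * s.esymm (j + 1) * powerSum s (n - j)) +
        (-1) ^ n * ((n + 1 : ℕ) : A) * s.esymm (n + 1) := by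
  obtain ⟨l, rfl⟩ := Quot.exists_rep s
  change powerSum (l : Multiset A) _ = _
  have hl : (l : Multiset A) = (Finset.univ : Finset (Fin l.length)).val.map l.get := by
    simp
  have he : ∀ k, MvPolynomial.aeval l.get (MvPolynomial.esymm (Fin l.length) ℤ k) =
      (l : Multiset A).esymm k := by
    intro k; rw [MvPolynomial.aeval_esymm_eq_multiset_esymm, ← hl]
  have hp : ∀ k, MvPolynomial.aeval l.get (MvPolynomial.psum (Fin l.length) ℤ k) =
      powerSum (l : Multiset A) k := by
    intro k
    rw [hl, MvPolynomial.psum, powerSum]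
    simp only [map_sum, map_pow, MvPolynomial.aeval_X, Multiset.map_map]
    rfl
  have h := congrArg (MvPolynomial.aeval l.get)
    (MvPolynomial.psum_eq_mul_esymm_sub_sum (Fin l.length) ℤ (n + 1) n.succ_pos)
  simp only [map_sub, map_sum, map_mul, map_pow, map_neg, map_one, he, hp, map_natCast] at h
  change powerSum (l : Multiset A) (n + 1) = (∑ j : Fin n, (-1) ^ (j : ℕ) *
    (l : Multiset A).esymm (j + 1) * powerSum (l : Multiset A) (n - j)) +
        (-1) ^ n * ((n + 1 : ℕ) : A) * (l : Multiset A).esymm (n + 1)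
  rw [h, Fin.sum_univ_eq_sum_range (fun j => (-1) ^ j * (l : Multiset A).esymm (j + 1) *
    powerSum (l : Multiset A) (n - j)), sub_eq_add_neg, add_comm, ← Finset.sum_neg_distrib]
  congr 1
  -- The pairs `(a, b)` have `a + b = n + 1` with `0 < a < n + 1`; shifting `a` by one gives the
  -- indices `j < n`.
  · refine Finset.sum_nbij' (fun a => a.1 - 1) (fun j => (j + 1, n - j)) ?_ ?_ ?_ ?_ ?_
    · rintro ⟨a, b⟩ h; simp at h ⊢; omega
    · intro j h; simp at h ⊢; omega
    · rintro ⟨a, b⟩ h; simp at h ⊢; omega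
    · intro j h; simp
    · rintro ⟨a, b⟩ h
      simp at h
      obtain ⟨a, rfl⟩ : ∃ c, a = c + 1 := ⟨a - 1, by omega⟩
      have : b = n - a := by omega
      subst this
      simp [pow_succ]
  · ring

/-- The splitting principle: any sequence of length `N` consists of the elementary symmetric
functions of `N` elements of an extension ring. -/
theorem exists_roots.{u} {A : Type u} [CommRing A] (a : ℕ → A) (ha : a 0 = 1) (N : ℕ) :
    ∃ (B : Type u) (_ : CommRing B) (f : A →+* B) (s : Multiset B),
      Function.Injective f ∧ s.card = N ∧ ∀ k ≤ N, s.esymm k = f (a k) := by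
  rcases subsingleton_or_nontrivial A with hA | hA
  · exact ⟨A, inferInstance, RingHom.id A, Multiset.replicate N 0, Function.injective_id, by simp,
      fun _ _ => Subsingleton.elim _ _⟩
  -- The reversed sequence gives a monic polynomial, since `a 0 = 1`. When it splits as a product of
  -- factors `X + ξ`, its coefficient at `X^(N-k)` is `e_k` of the `ξ`.
  set p : A[X] := X ^ N + ∑ k ∈ Finset.range N, C (a (N - k)) * X ^ k with hp
  have hcoeff : ∀ k ≤ N, p.coeff (N - k) = a k := by
    intro k hk
    simp only [hp, coeff_add, coeff_X_pow, finsetSum_coeff, coeff_C_mul, mul_ite, mul_one, mul_zero]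
    rcases Nat.eq_zero_or_pos k with rfl | hk0
    · rw [Finset.sum_eq_zero]
      · simp [ha]
      · intro j hj; rw [if_neg]; have := Finset.mem_range.1 hj; omega
    · rw [if_neg (by omega), zero_add, Finset.sum_eq_single_of_mem (N - k)
        (Finset.mem_range.2 (by omega)) (by grind), if_pos rfl]
      congr 1; omega
  have hdeg : (∑ k ∈ Finset.range N, C (a (N - k)) * X ^ k).degree < (N : WithBot ℕ) := by
    refine (degree_sum_le _ _).trans_lt ((Finset.sup_lt_iff (WithBot.bot_lt_coe N)).2 ?_)
    intro k hk
    exact (degree_C_mul_X_pow_le _ _).trans_lt (WithBot.coe_lt_coe.2 (Finset.mem_range.1 hk))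
  have hmon : p.Monic := monic_X_pow_add hdeg
  have hnd : p.natDegree = N := by
    apply natDegree_eq_of_degree_eq_some
    rw [hp, degree_add_eq_left_of_degree_lt] <;> rw [degree_X_pow]
    exact hdeg
  obtain ⟨S, _, _, _, _, _, hS⟩ := hmon.exists_splits_map
  obtain ⟨m, hm⟩ := splits_iff_exists_multiset'.1 hS
  rw [(hmon.map _).leadingCoeff, C_1, one_mul] at hm
  have hcard : m.card = N := by
    have := congrArg natDegree hm
    rw [hmon.natDegree_map, hnd, natDegree_multiset_prod_of_monic] at this
    · simpa using this.symm
    · intro q hq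
      obtain ⟨r, -, rfl⟩ := Multiset.mem_map.1 hq
      exact monic_X_add_C r
  refine ⟨S, inferInstance, algebraMap A S, m, FaithfulSMul.algebraMap_injective A S, hcard, ?_⟩
  intro k hk
  have := m.prod_X_add_C_coeff (k := N - k) (by omega)
  rw [← hm, coeff_map, hcoeff k hk, hcard, Nat.sub_sub_self hk] at this
  exact this.symm

end Roots

end LambdaPsi

namespace LambdaPsi

open MvPolynomial

/-! ### The universal polynomials evaluated at elementary symmetric functions -/

section Universal

variable {A B : Type*} [CommRing A] [CommRing B]

/-- The elements of `s` are formal roots, up to order `N`, of the power series with coefficients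
`a k`, after extension of scalars along `f`. -/
def IsRoots (f : A →+* B) (a : ℕ → A) (N : ℕ) (s : Multiset B) : Prop :=
  ∀ k ≤ N, s.esymm k = f (a k)

theorem IsRoots.map {C : Type*} [CommRing C] {f : A →+* B} {a : ℕ → A} {N : ℕ} {s : Multiset B}
    (hs : IsRoots f a N s) (g : B →+* C) : IsRoots (g.comp f) a N (s.map g) := fun k hk => by
  rw [map_esymm, hs k hk, RingHom.comp_apply]

/-- The recursion defining `adams` is Newton's identity, so no axiom on `lam` enters. Positivity of
`n` matters: `p_0` is the number of roots, while `adams` takes the default value `0` there. -/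
theorem powerSum_eq_adams {R : Type*} [CommRing R] {f : R →+* B} {lam : ℕ → R → R} {r : R} {N : ℕ}
    {s : Multiset B} (hs : IsRoots f (lam · r) N s) {n : ℕ} (hn : 0 < n) (hnN : n ≤ N) :
    powerSum s n = f (adams lam n r) := by
  induction n using Nat.strong_induction_on with
  | _ n ih =>
    obtain ⟨n, rfl⟩ : ∃ m, n = m + 1 := ⟨n - 1, by omega⟩
    rw [powerSum_newton, adams]
    simp only [map_add, map_sum, map_mul, map_pow, map_neg, map_one, map_natCast]
    rw [hs _ hnN]
    congr 1
    refine Finset.sum_congr rfl fun j _ => ?_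
    rw [hs _ (by omega), ih _ (by omega) (by omega) (by omega)]

/-- Both power sums are the same Newton expression, obtained by treating the elementary symmetric
functions of `t` as constant operations. -/
theorem powerSum_congr {s t : Multiset A} {N : ℕ} (h : ∀ k ≤ N, s.esymm k = t.esymm k)
    {n : ℕ} (hn : 0 < n) (hnN : n ≤ N) : powerSum s n = powerSum t n :=
  (powerSum_eq_adams (f := RingHom.id A) (lam := fun k _ => t.esymm k) (r := 0) h hn hnN).trans
    (powerSum_eq_adams (f := RingHom.id A) (lam := fun k _ => t.esymm k) (r := 0)
      (fun _ _ => rfl) hn hnN).symm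

/-- Newton's identity isolates `n e_n`, so recovering `e_n` from power sums requires dividing by
`n`. -/
theorem esymm_congr (hA : ∀ n : ℕ, 0 < n → IsUnit (n : A)) {s t : Multiset A} {N : ℕ}
    (h : ∀ k, 0 < k → k ≤ N → powerSum s k = powerSum t k) {n : ℕ} (hnN : n ≤ N) :
    s.esymm n = t.esymm n := by
  induction n using Nat.strong_induction_on with
  | _ n ih =>
    rcases n with _ | n
    · rw [esymm_zero, esymm_zero]
    · have h1 := h (n + 1) n.succ_pos hnN
      rw [powerSum_newton, powerSum_newton] at h1
      have h2 : ∀ j : Fin n, (-1) ^ (j : ℕ) * s.esymm (j + 1) * powerSum s (n - j) =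
          (-1) ^ (j : ℕ) * t.esymm (j + 1) * powerSum t (n - j) := fun j => by
        rw [ih _ (by omega) (by omega), h _ (by omega) (by omega)]
      rw [Finset.sum_congr rfl fun j _ => h2 j] at h1
      have h3 := add_left_cancel h1
      have hu : IsUnit ((-1 : A) ^ n * ((n + 1 : ℕ) : A)) :=
        ((isUnit_one.neg).pow n).mul (hA _ n.succ_pos)
      exact hu.mul_left_cancel h3

theorem map_aeval_int {σ : Type*} (f : A →+* B) (v : σ → A) (p : MvPolynomial σ ℤ) :
    f (aeval v p) = aeval (fun i => f (v i)) p :=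
  comp_aeval_apply (φ := f.toIntAlgHom) v p

theorem exists_eq_map_univ {α : Type*} (s : Multiset α) :
    ∃ ξ : Fin s.card → α, (Finset.univ : Finset (Fin s.card)).val.map ξ = s := by
  obtain ⟨l, rfl⟩ := Quot.exists_rep s
  exact ⟨l.get, by simpa only [List.ofFn_get] using! Fin.univ_val_map l.get⟩

theorem isUnit_natCast_of_hom {K : Type*} [Field K] [CharZero K] (f : K →+* B) (n : ℕ)
    (hn : 0 < n) : IsUnit (n : B) := by
  rw [← map_natCast f]
  exact (isUnit_iff_ne_zero.2 (by exact_mod_cast hn.ne')).map f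

theorem mulRoots_map_map {ι κ : Type*} (m : Multiset ι) (n : Multiset κ) (ξ : ι → A) (η : κ → A) :
    mulRoots (m.map ξ) (n.map η) = (m ×ˢ n).map fun p => ξ p.1 * η p.2 := by
  induction m using Multiset.induction_on with
  | empty => simp [mulRoots]
  | cons a m ih => simp [cons_mulRoots, ih, Multiset.map_map]

theorem aeval_prodPoly_of_card {s t : Multiset A} {k : ℕ} (hs : s.card = k) (ht : t.card = k) :
    aeval (Sum.elim (fun i : Fin k => s.esymm (i + 1)) (fun i : Fin k => t.esymm (i + 1)))
      (prodPoly k) = (mulRoots s t).esymm k := by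
  subst hs
  obtain ⟨ξ, hξ⟩ := exists_eq_map_univ s
  obtain ⟨η, hη⟩ : ∃ η : Fin s.card → A, (Finset.univ : Finset (Fin s.card)).val.map η = t := by
    rw [← ht]; exact exists_eq_map_univ t
  have h := congrArg (aeval (Sum.elim ξ η)) (prodPoly_spec s.card)
  have hl : aeval (Sum.elim ξ η) (aeval (esymmPair s.card s.card s.card) (prodPoly s.card)) =
      aeval (Sum.elim (fun i : Fin s.card => s.esymm (i + 1))
        (fun i : Fin s.card => t.esymm (i + 1)))
        (prodPoly s.card) := by
    rw [comp_aeval_apply]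
    congr 2
    funext i
    rcases i with i | i
    · rw [esymmPair, Sum.elim_inl, aeval_rename, aeval_esymm_eq_multiset_esymm, Sum.elim_comp_inl,
        hξ, Sum.elim_inl]
    · rw [esymmPair, Sum.elim_inr, aeval_rename, aeval_esymm_eq_multiset_esymm, Sum.elim_comp_inr,
        hη, Sum.elim_inr]
  rw [← hl, h, prodCoeff, ← coeff_rootPoly]
  have hc : ∀ F : Polynomial (MvPolynomial (Fin s.card ⊕ Fin s.card) ℤ),
      aeval (Sum.elim ξ η) (F.coeff s.card) =
        (F.map (aeval (Sum.elim ξ η) : _ →ₐ[ℤ] A).toRingHom).coeff s.card := by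
    intro F; simp
  rw [hc]
  congr 1
  have hr : mulRoots s t = ((Finset.univ : Finset (Fin s.card)) ×ˢ
      (Finset.univ : Finset (Fin s.card))).val.map (fun p => ξ p.1 * η p.2) := by
    rw [Finset.product_val, ← mulRoots_map_map, hξ, hη]
  rw [hr, rootPoly, Multiset.map_map]
  change _ = ∏ p ∈ (Finset.univ : Finset (Fin s.card)) ×ˢ (Finset.univ : Finset (Fin s.card)),
    (1 + Polynomial.C (ξ p.1 * η p.2) * Polynomial.X)
  rw [Finset.prod_product]
  simp [Polynomial.map_prod]

theorem aeval_compPoly_of_card {s : Multiset A} {k l : ℕ} (hs : s.card = k * l) :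
    aeval (fun i : Fin (k * l) => s.esymm (i + 1)) (compPoly k l) = (extRoots l s).esymm k := by
  obtain ⟨ξ, hξ⟩ : ∃ ξ : Fin (k * l) → A, (Finset.univ : Finset (Fin (k * l))).val.map ξ = s := by
    rw [← hs]; exact exists_eq_map_univ s
  have h := congrArg (aeval ξ) (compPoly_spec k l)
  have hl : aeval ξ (aeval (fun i : Fin (k * l) => esymm (Fin (k * l)) ℤ (i + 1)) (compPoly k l)) =
      aeval (fun i : Fin (k * l) => s.esymm (i + 1)) (compPoly k l) := by
    rw [comp_aeval_apply]
    congr 2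
    funext i
    rw [aeval_esymm_eq_multiset_esymm, hξ]
  rw [← hl, h, compCoeff, ← coeff_rootPoly]
  have hc : ∀ F : Polynomial (MvPolynomial (Fin (k * l)) ℤ),
      aeval ξ (F.coeff k) = (F.map (aeval ξ : _ →ₐ[ℤ] A).toRingHom).coeff k := by
    intro F; simp
  rw [hc]
  congr 1
  have hr : extRoots l s = (Finset.powersetCard l (Finset.univ : Finset (Fin (k * l)))).val.map
      (fun S => ∏ i ∈ S, ξ i) := by
    rw [← hξ, extRoots, Multiset.powersetCard_map, ← Finset.map_val_val_powersetCard]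
    simp only [Multiset.map_map]
    rfl
  rw [hr, rootPoly, Multiset.map_map]
  change _ = ∏ S ∈ Finset.powersetCard l (Finset.univ : Finset (Fin (k * l))),
    (1 + Polynomial.C (∏ i ∈ S, ξ i) * Polynomial.X)
  simp [Polynomial.map_prod]

/-- Only `e_1, ..., e_k` enter, so `s` and `t` may be replaced by families of exactly `k` elements
in an extension. The power sums of the products are unchanged up to order `k`, hence so is `e_k`. -/
theorem aeval_prodPoly_of_isUnit (hA : ∀ n : ℕ, 0 < n → IsUnit (n : A)) (s t : Multiset A)
    (k : ℕ) :
    aeval (Sum.elim (fun i : Fin k => s.esymm (i + 1)) (fun i : Fin k => t.esymm (i + 1)))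
      (prodPoly k) = (mulRoots s t).esymm k := by
  obtain ⟨B, _, f, s', hf, hs', hs⟩ := exists_roots s.esymm (esymm_zero s) k
  obtain ⟨C, _, g, t', hg, ht', ht⟩ := exists_roots (t.map f).esymm (esymm_zero _) k
  have hC : ∀ n : ℕ, 0 < n → IsUnit (n : C) := fun n hn => by
    rw [← map_natCast (g.comp f)]
    exact (hA n hn).map _
  have hs1 : ∀ i ≤ k, (s'.map g).esymm i = ((s.map f).map g).esymm i := fun i hi => by
    rw [map_esymm, map_esymm, map_esymm, hs i hi]
  have ht1 : ∀ i ≤ k, t'.esymm i = ((t.map f).map g).esymm i := fun i hi => by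
    rw [map_esymm g, ht i hi]
  apply hf
  apply hg
  rw [map_aeval_int, map_aeval_int, ← map_esymm, ← map_esymm, map_mulRoots, map_mulRoots,
    ← esymm_congr (N := k) hC (s := mulRoots (s'.map g) t') _ le_rfl,
    ← aeval_prodPoly_of_card (by simpa using hs') ht']
  · congr 2
    funext i
    rcases i with i | i
    · rw [Sum.elim_inl, Sum.elim_inl, hs1 _ (by omega), map_esymm, map_esymm]
    · rw [Sum.elim_inr, Sum.elim_inr, ht1 _ (by omega), map_esymm, map_esymm]
  · intro n hn hnk
    rw [powerSum_mulRoots, powerSum_mulRoots, powerSum_congr hs1 hn hnk, powerSum_congr ht1 hn hnk]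

theorem map_aeval_prodPoly_esymm (f : A →+* B) (s t : Multiset A) (k : ℕ) :
    f (aeval (Sum.elim (fun i : Fin k => s.esymm (i + 1)) (fun i : Fin k => t.esymm (i + 1)))
      (prodPoly k)) =
    aeval (Sum.elim (fun i : Fin k => (s.map f).esymm (i + 1))
      (fun i : Fin k => (t.map f).esymm (i + 1))) (prodPoly k) := by
  rw [map_aeval_int]
  congr 2
  funext i
  rcases i with i | i <;> simp [map_esymm]

theorem aeval_prodPoly_map_iff {f : A →+* B} (hf : Function.Injective f) (s t : Multiset A) (k : ℕ) :
    aeval (Sum.elim (fun i : Fin k => (s.map f).esymm (i + 1))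
      (fun i : Fin k => (t.map f).esymm (i + 1))) (prodPoly k) =
        (mulRoots (s.map f) (t.map f)).esymm k ↔
    aeval (Sum.elim (fun i : Fin k => s.esymm (i + 1)) (fun i : Fin k => t.esymm (i + 1)))
      (prodPoly k) = (mulRoots s t).esymm k := by
  rw [← hf.eq_iff, map_aeval_prodPoly_esymm, ← map_esymm, map_mulRoots]

/-- `P_k` evaluated at the elementary symmetric functions of two finite families of any length. -/
theorem aeval_prodPoly (s t : Multiset A) (k : ℕ) :
    aeval (Sum.elim (fun i : Fin k => s.esymm (i + 1)) (fun i : Fin k => t.esymm (i + 1)))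
      (prodPoly k) = (mulRoots s t).esymm k := by
  obtain ⟨ξ, hξ⟩ := exists_eq_map_univ s
  obtain ⟨η, hη⟩ := exists_eq_map_univ t
  let x : Fin s.card → MvPolynomial (Fin s.card ⊕ Fin t.card) ℤ := fun i => X (Sum.inl i)
  let y : Fin t.card → MvPolynomial (Fin s.card ⊕ Fin t.card) ℤ := fun i => X (Sum.inr i)
  -- The identity holds for indeterminates over `ℚ`, descends to `ℤ` by injectivity of the
  -- coefficient map, and specialises to any ring.
  have key := (aeval_prodPoly_map_iff
    (MvPolynomial.map_injective (Int.castRingHom ℚ) Int.cast_injective)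
    (Finset.univ.val.map x) (Finset.univ.val.map y) k).1
      (aeval_prodPoly_of_isUnit (isUnit_natCast_of_hom (C : ℚ →+* _)) _ _ k)
  have h := congrArg (aeval (Sum.elim ξ η) : _ →ₐ[ℤ] A).toRingHom key
  have hx : (Finset.univ.val.map x).map (aeval (Sum.elim ξ η) : _ →ₐ[ℤ] A).toRingHom = s := by
    rw [Multiset.map_map]; simpa [x, Function.comp_def] using hξ
  have hy : (Finset.univ.val.map y).map (aeval (Sum.elim ξ η) : _ →ₐ[ℤ] A).toRingHom = t := by
    rw [Multiset.map_map]; simpa [y, Function.comp_def] using hη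
  rwa [map_aeval_prodPoly_esymm, ← map_esymm, map_mulRoots, hx, hy] at h

theorem aeval_compPoly_of_isUnit (hA : ∀ n : ℕ, 0 < n → IsUnit (n : A)) (s : Multiset A)
    (k l : ℕ) :
    aeval (fun i : Fin (k * l) => s.esymm (i + 1)) (compPoly k l) = (extRoots l s).esymm k := by
  rcases Nat.eq_zero_or_pos k with rfl | hk
  · have h := aeval_compPoly_of_card (A := A) (s := 0) (k := 0) (l := l) (by simp)
    rw [esymm_zero] at h ⊢
    rw [← h]
    congr 2
    funext i
    exact absurd i.2 (by simp)
  obtain ⟨B, _, f, s', hf, hs', hs⟩ := exists_roots s.esymm (esymm_zero s) (k * l)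
  have hB : ∀ n : ℕ, 0 < n → IsUnit (n : B) := fun n hn => by
    rw [← map_natCast f]
    exact (hA n hn).map _
  have hs1 : ∀ i ≤ k * l, s'.esymm i = (s.map f).esymm i := fun i hi => by
    rw [map_esymm, hs i hi]
  apply hf
  rw [map_aeval_int, ← map_esymm, map_extRoots,
    ← esymm_congr (N := k) hB (s := extRoots l s') _ le_rfl, ← aeval_compPoly_of_card hs']
  · congr 2
    funext i
    rw [hs1 _ (by omega), map_esymm]
  · intro n hn hnk
    rw [← map_pow_esymm, ← map_pow_esymm]
    refine esymm_congr (N := l) hB ?_ le_rfl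
    intro m hm hml
    rw [powerSum_map_pow, powerSum_map_pow]
    exact powerSum_congr hs1 (Nat.mul_pos hn hm) (Nat.mul_le_mul hnk hml)

theorem map_aeval_compPoly_esymm (f : A →+* B) (s : Multiset A) (k l : ℕ) :
    f (aeval (fun i : Fin (k * l) => s.esymm (i + 1)) (compPoly k l)) =
      aeval (fun i : Fin (k * l) => (s.map f).esymm (i + 1)) (compPoly k l) := by
  simp only [map_aeval_int, map_esymm]

theorem aeval_compPoly_map_iff {f : A →+* B} (hf : Function.Injective f) (s : Multiset A)
    (k l : ℕ) :
    aeval (fun i : Fin (k * l) => (s.map f).esymm (i + 1)) (compPoly k l) =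
        (extRoots l (s.map f)).esymm k ↔
    aeval (fun i : Fin (k * l) => s.esymm (i + 1)) (compPoly k l) = (extRoots l s).esymm k := by
  rw [← hf.eq_iff, map_aeval_compPoly_esymm, ← map_esymm, map_extRoots]

/-- `P_{k,l}` evaluated at the elementary symmetric functions of a finite family of any length. -/
theorem aeval_compPoly (s : Multiset A) (k l : ℕ) :
    aeval (fun i : Fin (k * l) => s.esymm (i + 1)) (compPoly k l) = (extRoots l s).esymm k := by
  obtain ⟨ξ, hξ⟩ := exists_eq_map_univ s
  have key := (aeval_compPoly_map_iff
    (MvPolynomial.map_injective (Int.castRingHom ℚ) Int.cast_injective)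
    ((Finset.univ : Finset (Fin s.card)).val.map X) k l).1
      (aeval_compPoly_of_isUnit (isUnit_natCast_of_hom (C : ℚ →+* _)) _ k l)
  have h := congrArg (aeval ξ : _ →ₐ[ℤ] A).toRingHom key
  have hx : ((Finset.univ : Finset (Fin s.card)).val.map X).map
      (aeval ξ : _ →ₐ[ℤ] A).toRingHom = s := by
    rw [Multiset.map_map]; simpa [Function.comp_def] using hξ
  rwa [map_aeval_compPoly_esymm, ← map_esymm, map_extRoots, hx] at h

theorem map_aeval_prodPoly {f : A →+* B} {a b : ℕ → A} {N : ℕ} {s t : Multiset B}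
    (hs : IsRoots f a N s) (ht : IsRoots f b N t) {k : ℕ} (hk : k ≤ N) :
    f (aeval (Sum.elim (fun i : Fin k => a (i + 1)) (fun i : Fin k => b (i + 1))) (prodPoly k)) =
      (mulRoots s t).esymm k := by
  rw [map_aeval_int, ← aeval_prodPoly]
  congr 2
  funext i
  rcases i with i | i
  · exact (hs _ (by omega)).symm
  · exact (ht _ (by omega)).symm

theorem map_aeval_compPoly {f : A →+* B} {a : ℕ → A} {N : ℕ} {s : Multiset B}
    (hs : IsRoots f a N s) {k l : ℕ} (hk : k * l ≤ N) :
    f (aeval (fun i : Fin (k * l) => a (i + 1)) (compPoly k l)) = (extRoots l s).esymm k := by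
  rw [map_aeval_int, ← aeval_compPoly]
  congr 2
  funext i
  exact (hs _ (by omega)).symm

end Universal

/-! ### The Ψ-ring associated with a λ-ring -/

section Adams

variable {R B : Type*} [CommRing R] [CommRing B] {lam : ℕ → R → R}

theorem IsPreLambdaRing.isRoots_add (h : IsPreLambdaRing lam) {f : R →+* B} {r r' : R} {N : ℕ}
    {s s' : Multiset B} (hs : IsRoots f (lam · r) N s) (hs' : IsRoots f (lam · r') N s') :
    IsRoots f (lam · (r + r')) N (s + s') := fun k hk => by
  dsimp only
  rw [esymm_add, h.lam_add, map_sum]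
  refine Finset.sum_congr rfl fun j hj => ?_
  have := Finset.mem_range.1 hj
  rw [map_mul, hs _ (by omega), hs' _ (by omega)]

theorem IsLambdaRing.isRoots_mul (h : IsLambdaRing lam) {f : R →+* B} {r r' : R} {N : ℕ}
    {s s' : Multiset B} (hs : IsRoots f (lam · r) N s) (hs' : IsRoots f (lam · r') N s') :
    IsRoots f (lam · (r * r')) N (mulRoots s s') := fun k hk => by
  dsimp only
  rw [h.lam_mul, map_aeval_prodPoly hs hs' hk]

theorem IsLambdaRing.isRoots_lam (h : IsLambdaRing lam) {f : R →+* B} {r : R} {N n l : ℕ}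
    {s : Multiset B} (hs : IsRoots f (lam · r) N s) (hN : n * l ≤ N) :
    IsRoots f (lam · (lam l r)) n (extRoots l s) := fun k hk => by
  dsimp only
  rw [h.lam_lam, map_aeval_compPoly hs ((Nat.mul_le_mul_right l hk).trans hN)]

theorem IsLambdaRing.isRoots_one (h : IsLambdaRing lam) (f : R →+* B) (N : ℕ) :
    IsRoots f (lam · 1) N {1} := fun k _ => by
  have h1 := congrArg (PowerSeries.coeff k) h.lamSeries_one
  rw [PowerSeries.coeff_mk] at h1
  dsimp only
  rw [h1, ← Multiset.cons_zero]
  rcases k with _ | _ | k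
  · simp [esymm_zero]
  · simp [esymm_one, PowerSeries.coeff_one]
  · rw [cons_esymm_succ]
    simp [zero_esymm_succ, PowerSeries.coeff_X, PowerSeries.coeff_one]

theorem IsPreLambdaRing.exists_isRoots.{u} {R : Type u} [CommRing R] {lam : ℕ → R → R}
    (h : IsPreLambdaRing lam) (r : R) (N : ℕ) :
    ∃ (B : Type u) (_ : CommRing B) (f : R →+* B) (s : Multiset B),
      Function.Injective f ∧ IsRoots f (lam · r) N s := by
  obtain ⟨B, hB, f, s, hf, -, hs⟩ := exists_roots (lam · r) (h.lam_zero r) N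
  exact ⟨B, hB, f, s, hf, hs⟩

theorem IsPreLambdaRing.exists_isRoots_pair.{u} {R : Type u} [CommRing R] {lam : ℕ → R → R}
    (h : IsPreLambdaRing lam) (r r' : R) (N : ℕ) :
    ∃ (B : Type u) (_ : CommRing B) (f : R →+* B) (s s' : Multiset B),
      Function.Injective f ∧ IsRoots f (lam · r) N s ∧ IsRoots f (lam · r') N s' := by
  obtain ⟨B, _, f, s, hf, hs⟩ := h.exists_isRoots r N
  obtain ⟨C, hC, g, t, hg, -, ht⟩ := exists_roots (fun k => f (lam k r'))
    (by rw [h.lam_zero, map_one]) N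
  exact ⟨C, hC, g.comp f, s.map g, t, hg.comp hf, hs.map g, ht⟩

theorem adams_one_left (h : IsPreLambdaRing lam) (r : R) : adams lam 1 r = r := by
  simp [adams, h.lam_one]

theorem IsLambdaRing.adams_one (h : IsLambdaRing lam) {i : ℕ} (hi : 0 < i) :
    adams lam i 1 = 1 := by
  rw [← RingHom.id_apply (adams lam i 1),
    ← powerSum_eq_adams (h.isRoots_one (RingHom.id R) i) hi le_rfl]
  simp [powerSum]

theorem IsPreLambdaRing.adams_add (h : IsPreLambdaRing lam) {i : ℕ} (hi : 0 < i) (r r' : R) :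
    adams lam i (r + r') = adams lam i r + adams lam i r' := by
  obtain ⟨B, _, f, s, s', hf, hs, hs'⟩ := h.exists_isRoots_pair r r' i
  apply hf
  rw [← powerSum_eq_adams (h.isRoots_add hs hs') hi le_rfl, powerSum_add, RingHom.map_add,
    powerSum_eq_adams hs hi le_rfl, powerSum_eq_adams hs' hi le_rfl]

theorem IsLambdaRing.adams_mul (h : IsLambdaRing lam) {i : ℕ} (hi : 0 < i) (r r' : R) :
    adams lam i (r * r') = adams lam i r * adams lam i r' := by
  obtain ⟨B, _, f, s, s', hf, hs, hs'⟩ := h.exists_isRoots_pair r r' i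
  apply hf
  rw [← powerSum_eq_adams (h.isRoots_mul hs hs') hi le_rfl, powerSum_mulRoots, RingHom.map_mul,
    powerSum_eq_adams hs hi le_rfl, powerSum_eq_adams hs' hi le_rfl]

/-- The Adams operations of a λ-ring as ring endomorphisms. -/
def IsLambdaRing.adamsHom (h : IsLambdaRing lam) (i : ℕ) (hi : 0 < i) : R →+* R :=
  RingHom.mk' ⟨⟨adams lam i, h.adams_one hi⟩, h.adams_mul hi⟩ (h.adams_add hi)

theorem IsLambdaRing.adamsHom_apply (h : IsLambdaRing lam) (i : ℕ) (hi : 0 < i) (r : R) :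
    h.adamsHom i hi r = adams lam i r := rfl

theorem IsLambdaRing.isPsiRing_adams (h : IsLambdaRing lam) : IsPsiRing (adams lam) where
  map_one _ hi := h.adams_one hi
  map_add _ hi := h.adams_add hi
  map_mul _ hi := h.adams_mul hi
  psi_one := adams_one_left h.toIsPreLambdaRing
  psi_psi i j hi hj r := by
    obtain ⟨B, _, f, s, hf, hs⟩ := h.exists_isRoots r (i * j)
    -- Along the ring homomorphism `f ∘ Ψ^i`, the roots of `r` are the `i`-th powers of the original
    -- ones, because `e_k(s^i) = p_i(extRoots k s) = f(Ψ^i(λ^k(r)))`. Their `j`-th power sum is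
    -- `p_{ij}(s)`.
    have hpow : IsRoots (f.comp (h.adamsHom i hi)) (lam · r) j (s.map (· ^ i)) := fun k hk => by
      rw [map_pow_esymm, RingHom.comp_apply, h.adamsHom_apply,
        powerSum_eq_adams (h.isRoots_lam hs (Nat.mul_le_mul_left i hk)) hi le_rfl]
    apply hf
    rw [← h.adamsHom_apply i hi, ← RingHom.comp_apply, ← powerSum_eq_adams hpow hj le_rfl,
      powerSum_map_pow, powerSum_eq_adams hs (Nat.mul_pos hi hj) le_rfl]

end Adams

end LambdaPsi

namespace LambdaPsi

open MvPolynomial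

/-! ### Families whose elementary symmetric functions have zero products -/

section Null

variable {A B : Type*} [CommRing A] [CommRing B]

theorem esymm_add_eq_add_sum_Icc (s t : Multiset A) (k : ℕ) :
    (s + t).esymm k = s.esymm k + ∑ j ∈ Finset.Icc 1 k, s.esymm (k - j) * t.esymm j := by
  rw [add_comm s t, esymm_add, Finset.sum_range_succ', add_comm, esymm_zero, one_mul, Nat.sub_zero,
    Finset.sum_bij' (fun j _ => j + 1) (fun j _ => j - 1)]
  all_goals intro j hj; simp at hj ⊢
  · omega
  · omega
  · omega
  · ring

theorem esymm_add_of_mul_eq_zero {s t : Multiset A}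
    (h : ∀ a b, 0 < a → 0 < b → s.esymm a * t.esymm b = 0) {k : ℕ} (hk : 0 < k) :
    (s + t).esymm k = s.esymm k + t.esymm k := by
  rw [esymm_add_eq_add_sum_Icc, Finset.sum_eq_single_of_mem k (Finset.mem_Icc.2 ⟨hk, le_rfl⟩)]
  · rw [Nat.sub_self, esymm_zero, one_mul]
  · intro j hj hjk
    have := Finset.mem_Icc.1 hj
    exact h _ _ (by omega) (by omega)

/-- The products of elementary symmetric functions of positive degree vanish. -/
def IsNull (t : Multiset A) : Prop := ∀ a b, 0 < a → 0 < b → t.esymm a * t.esymm b = 0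

theorem IsNull.powerSum_eq {t : Multiset A} (ht : IsNull t) {n : ℕ} (hn : 0 < n) :
    powerSum t n = (-1) ^ (n + 1) * (n : A) * t.esymm n := by
  induction n using Nat.strong_induction_on with
  | _ n ih =>
    obtain ⟨n, rfl⟩ : ∃ m, n = m + 1 := ⟨n - 1, by omega⟩
    rw [powerSum_newton, Finset.sum_eq_zero, zero_add]
    · ring
    · intro j _
      rw [ih _ (by omega) (by omega), mul_mul_mul_comm, ht _ _ (by omega) (by omega), mul_zero]

/-- The products form a union of scaled copies `a·t`, with `e_k(a·t) = a^k e_k(t)`. All cross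
products vanish, so these contributions add up to the power sum of `s`. -/
theorem IsNull.esymm_mulRoots {t : Multiset A} (ht : IsNull t) (s : Multiset A) {k : ℕ}
    (hk : 0 < k) : (mulRoots s t).esymm k = powerSum s k * t.esymm k := by
  induction s using Multiset.induction_on generalizing k with
  | empty =>
    obtain ⟨k, rfl⟩ : ∃ m, k = m + 1 := ⟨k - 1, by omega⟩
    rw [zero_mulRoots, zero_esymm_succ]
    simp [powerSum]
  | cons a s ih =>
    have ha : ∀ k, (t.map (a * ·)).esymm k = a ^ k * t.esymm k := fun k =>
      (Multiset.pow_smul_esymm a k t).symm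
    rw [cons_mulRoots, esymm_add_of_mul_eq_zero _ hk, ih hk, ha, powerSum_cons, add_mul]
    intro i j hi hj
    rw [ha, ih hj, mul_mul_mul_comm, ht i j hi hj, mul_zero]

/-- If `x` kills all power sums, Newton's identity and division show that it kills all `e_b`. This
is applied first to `x = p_a`, then to `x = e_a`. -/
theorem isNull_of_powerSum (hA : ∀ n : ℕ, 0 < n → IsUnit (n : A)) {s : Multiset A}
    (h : ∀ a b, 0 < a → 0 < b → powerSum s a * powerSum s b = 0) : IsNull s := by
  have key : ∀ x : A, (∀ b, 0 < b → x * powerSum s b = 0) → ∀ b, 0 < b → x * s.esymm b = 0 := by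
    intro x hx b hb
    obtain ⟨b, rfl⟩ : ∃ m, b = m + 1 := ⟨b - 1, by omega⟩
    have h1 := hx (b + 1) hb
    rw [powerSum_newton, mul_add, Finset.mul_sum, Finset.sum_eq_zero, zero_add] at h1
    · have hu : IsUnit ((-1 : A) ^ b * ((b + 1 : ℕ) : A)) :=
        ((isUnit_one.neg).pow b).mul (hA _ b.succ_pos)
      rw [mul_left_comm] at h1
      exact hu.mul_right_eq_zero.1 h1
    · intro j _
      rw [mul_left_comm, hx _ (by omega), mul_zero]
  have key2 : ∀ a b, 0 < a → 0 < b → powerSum s a * s.esymm b = 0 := fun a b ha hb =>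
    key _ (fun b hb => h a b ha hb) b hb
  exact fun a b ha hb => key _ (fun b hb => by rw [mul_comm]; exact key2 b a hb ha) b hb

theorem neg_one_pow_sign (k l : ℕ) :
    (-1 : A) ^ (k + 1) * ((-1) ^ (l + 1) * (-1) ^ (k * l + 1)) = (-1) ^ ((k + 1) * (l + 1)) := by
  rw [← pow_add, ← pow_add, show k + 1 + (l + 1 + (k * l + 1)) = (k + 1) * (l + 1) + 2 by ring,
    pow_add]
  simp

/-- Both `extRoots l t` and the family of `k`-th powers of `t` are null, so each power sum is a
signed multiple of an `e`. Computing `p_{kl}(t) = p_l(t^k)` with `e_l(t^k) = p_k(extRoots l t)`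
gives the claim multiplied by `k l`, which is cancelled. -/
theorem IsNull.esymm_extRoots_of_isUnit (hA : ∀ n : ℕ, 0 < n → IsUnit (n : A)) {t : Multiset A}
    (ht : IsNull t) {k l : ℕ} (hk : 0 < k) (hl : 0 < l) :
    (extRoots l t).esymm k = (-1) ^ ((k + 1) * (l + 1)) * t.esymm (k * l) := by
  have hp : ∀ a b, 0 < a → 0 < b → powerSum t a * powerSum t b = 0 := fun a b ha hb => by
    rw [ht.powerSum_eq ha, ht.powerSum_eq hb, mul_mul_mul_comm, ht a b ha hb, mul_zero]
  have hpow : ∀ k, 0 < k → IsNull (t.map (· ^ k)) := fun k hk => isNull_of_powerSum hA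
    fun a b ha hb => by
      rw [powerSum_map_pow, powerSum_map_pow]
      exact hp _ _ (Nat.mul_pos hk ha) (Nat.mul_pos hk hb)
  have hext : IsNull (extRoots l t) := isNull_of_powerSum hA fun a b ha hb => by
    have h1 := (hpow a ha).powerSum_eq hl
    have h2 := (hpow b hb).powerSum_eq hl
    rw [powerSum_map_pow, map_pow_esymm] at h1 h2
    have h3 := hp _ _ (Nat.mul_pos ha hl) (Nat.mul_pos hb hl)
    have hu : IsUnit ((-1 : A) ^ (l + 1) * (l : A)) := ((isUnit_one.neg).pow _).mul (hA _ hl)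
    rw [h1, h2, mul_mul_mul_comm] at h3
    exact (hu.mul hu).mul_right_eq_zero.1 h3
  have h1 := hext.powerSum_eq hk
  have h2 := (hpow k hk).powerSum_eq hl
  rw [powerSum_map_pow, map_pow_esymm, h1, ht.powerSum_eq (Nat.mul_pos hk hl)] at h2
  refine ((hA k hk).mul (hA l hl)).mul_left_cancel ?_
  have hsq : ∀ n : ℕ, (-1 : A) ^ n * (-1) ^ n = 1 := fun n => by rw [← mul_pow]; simp
  rw [← neg_one_pow_sign]
  push_cast at h2
  linear_combination (-(-1) ^ (k + 1) * (-1) ^ (l + 1)) * h2 -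
    k * l * (extRoots l t).esymm k * (hsq (k + 1) * (-1) ^ (l + 1) * (-1) ^ (l + 1) + hsq (l + 1))

theorem aeval_of_mul_eq_zero {σ : Type*} [Fintype σ] {v : σ → A} (hv : ∀ i j, v i * v j = 0)
    (p : MvPolynomial σ ℤ) :
    aeval v p = ((coeff 0 p : ℤ) : A) +
      ∑ i, ((coeff (Finsupp.single i 1) p : ℤ) : A) * v i := by
  classical
  induction p using MvPolynomial.induction_on with
  | C a =>
    rw [aeval_C, coeff_C, if_pos rfl, Finset.sum_eq_zero]
    · simp
    · intro i _
      rw [coeff_C, if_neg (by simp [eq_comm])]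
      simp
  | add p q hp hq =>
    simp only [map_add, hp, hq, coeff_add, Int.cast_add, add_mul, Finset.sum_add_distrib]
    ring
  | mul_X p i hp =>
    rw [map_mul, aeval_X, hp, add_mul, Finset.sum_mul, Finset.sum_eq_zero, coeff_mul_X',
      if_neg (by simp), Finset.sum_eq_single_of_mem i (Finset.mem_univ i), coeff_mul_X',
      if_pos (by simp)]
    · simp
    · intro j _ hj
      rw [coeff_mul_X', if_neg (by simp [hj.symm]), Int.cast_zero, zero_mul]
    · intro j _
      rw [mul_assoc, hv, mul_zero]

/-- The constant and linear coefficients are read off in a test ring, the square-zero extension of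
`ℚ` by `ℚ^{kl}`, with the basis vectors as `e_1, ..., e_{kl}`. There the rational case of the
exterior power formula applies. -/
theorem coeff_compPoly {k l : ℕ} (hk : 0 < k) (hl : 0 < l) :
    coeff 0 (compPoly k l) = 0 ∧ ∀ i : Fin (k * l), coeff (Finsupp.single i 1) (compPoly k l) =
      if (i : ℕ) + 1 = k * l then (-1) ^ ((k + 1) * (l + 1)) else 0 := by
  have hkl := Nat.mul_pos hk hl
  let e : ℕ → TrivSqZeroExt ℚ (Fin (k * l) → ℚ) := fun n =>
    if n = 0 then 1 else TrivSqZeroExt.inr (fun i => if (i : ℕ) + 1 = n then 1 else 0)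
  have he : ∀ n, 0 < n → e n =
      TrivSqZeroExt.inr (fun i : Fin (k * l) => if (i : ℕ) + 1 = n then (1 : ℚ) else 0) :=
    fun n hn => by simp only [e, if_neg hn.ne']
  obtain ⟨B, _, f, t, hf, hcard, ht⟩ := exists_roots e (if_pos rfl) (k * l)
  have hB := isUnit_natCast_of_hom (f.comp (TrivSqZeroExt.inlHom ℚ (Fin (k * l) → ℚ)))
  have hnull : IsNull t := fun a b ha hb => by
    rcases le_or_gt a (k * l) with ha' | ha'
    · rcases le_or_gt b (k * l) with hb' | hb'
      · rw [ht a ha', ht b hb', he a ha, he b hb, ← map_mul, TrivSqZeroExt.inr_mul_inr, map_zero]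
      · rw [esymm_eq_zero_of_card_lt t (k := b) (hcard ▸ hb'), mul_zero]
    · rw [esymm_eq_zero_of_card_lt t (hcard ▸ ha'), zero_mul]
  have h := hnull.esymm_extRoots_of_isUnit hB hk hl
  rw [← map_aeval_compPoly (f := f) (a := e) (N := k * l) ht le_rfl, ht _ le_rfl,
    aeval_of_mul_eq_zero fun i j => by
      rw [he _ (by omega), he _ (by omega), TrivSqZeroExt.inr_mul_inr],
    ← map_one f, ← map_neg, ← map_pow, ← map_mul] at h
  have h := hf h
  simp only [he _ hkl, he _ (Nat.succ_pos _)] at h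
  have hint : ∀ z : ℤ, (z : TrivSqZeroExt ℚ (Fin (k * l) → ℚ)) = TrivSqZeroExt.inl (z : ℚ) :=
    fun z => (TrivSqZeroExt.inl_intCast z).symm
  have hsign : (-1 : TrivSqZeroExt ℚ (Fin (k * l) → ℚ)) ^ ((k + 1) * (l + 1)) =
      TrivSqZeroExt.inl (((-1) ^ ((k + 1) * (l + 1)) : ℤ) : ℚ) := by
    rw [← hint]; push_cast; rfl
  simp only [hint, hsign, TrivSqZeroExt.inl_mul_inr, ← TrivSqZeroExt.inr_sum] at h
  constructor
  · have h1 := congrArg TrivSqZeroExt.fst h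
    simpa using h1
  · intro i
    have h1 := congrFun (congrArg TrivSqZeroExt.snd h) i
    simp [Finset.sum_apply, Fin.val_inj] at h1
    rw [← @Int.cast_inj ℚ, h1]
    push_cast
    rfl

/-- For null `t` only the constant and linear terms of `P_{k,l}` survive. Since these are known
integers, no division in `A` is needed. -/
theorem IsNull.esymm_extRoots {t : Multiset A} (ht : IsNull t) {k l : ℕ} (hk : 0 < k)
    (hl : 0 < l) : (extRoots l t).esymm k = (-1) ^ ((k + 1) * (l + 1)) * t.esymm (k * l) := by
  have hkl := Nat.mul_pos hk hl
  obtain ⟨h0, h1⟩ := coeff_compPoly hk hl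
  rw [← aeval_compPoly, aeval_of_mul_eq_zero fun i j => ht _ _ (by omega) (by omega), h0,
    Int.cast_zero, zero_add, Finset.sum_eq_single_of_mem ⟨k * l - 1, by omega⟩ (Finset.mem_univ _),
    h1, if_pos (by simp; omega)]
  · simp only [Nat.sub_add_cancel hkl]
    push_cast
    rfl
  · intro j _ hj
    rw [h1, if_neg (fun h => hj (Fin.ext (by simp; omega))), Int.cast_zero, zero_mul]

end Null

end LambdaPsi

namespace LambdaPsi

/-! ### The λ-ring `R ⋊ M` -/

section Semidirect

set_option linter.unusedSectionVars false

variable {R M : Type*} [CommRing R] [AddCommGroup M] [Module R M] [Module Rᵐᵒᵖ M]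
  [IsCentralScalar R M] {B C : Type*} [CommRing B] [CommRing C]
  {lam : ℕ → R → R} {Lam : ℕ → M → M}

/-- The ideal of `B` generated by the image of `M`. -/
def moduleIdeal (f : TrivSqZeroExt R M →+* B) : Ideal B :=
  Ideal.span (Set.range fun m => f (TrivSqZeroExt.inr m))

theorem mul_eq_zero_of_mem_moduleIdeal {f : TrivSqZeroExt R M →+* B} {x y : B}
    (hx : x ∈ moduleIdeal f) (hy : y ∈ moduleIdeal f) : x * y = 0 := by
  have h : moduleIdeal f * moduleIdeal f = ⊥ := by
    rw [moduleIdeal, Ideal.span_mul_span', Ideal.span_eq_bot]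
    rintro _ ⟨_, ⟨m, rfl⟩, _, ⟨n, rfl⟩, rfl⟩
    simp only [← map_mul, TrivSqZeroExt.inr_mul_inr, map_zero]
  simpa [h] using Ideal.mul_mem_mul hx hy

/-- The elements of `t` are formal roots, up to order `N`, of `1 + ∑ Λ^k(m) t^k`, and all their
elementary symmetric functions of positive degree lie in the ideal generated by `M`. -/
structure IsModuleRoots (f : TrivSqZeroExt R M →+* B) (Lam : ℕ → M → M) (m : M) (N : ℕ)
    (t : Multiset B) : Prop where
  mem : ∀ k, 0 < k → t.esymm k ∈ moduleIdeal f
  eq : ∀ k, 0 < k → k ≤ N → t.esymm k = f (TrivSqZeroExt.inr (Lam k m))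

theorem IsLambdaModule.map_zero (h : IsLambdaModule lam Lam) {k : ℕ} (hk : 0 < k) :
    Lam k 0 = 0 := by
  have := h.map_add k hk 0 0
  rwa [add_zero, left_eq_add] at this

namespace IsModuleRoots

variable {f : TrivSqZeroExt R M →+* B} {m n : M} {N : ℕ} {t t' : Multiset B}

theorem mul_eq_zero (ht : IsModuleRoots f Lam m N t) (ht' : IsModuleRoots f Lam n N t') (a b : ℕ)
    (ha : 0 < a) (hb : 0 < b) : t.esymm a * t'.esymm b = 0 :=
  mul_eq_zero_of_mem_moduleIdeal (ht.mem a ha) (ht'.mem b hb)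

theorem isNull (ht : IsModuleRoots f Lam m N t) : IsNull t := ht.mul_eq_zero ht

theorem map (ht : IsModuleRoots f Lam m N t) (g : B →+* C) :
    IsModuleRoots (g.comp f) Lam m N (t.map g) where
  mem k hk := by
    rw [map_esymm, moduleIdeal]
    have := Ideal.mem_map_of_mem g (ht.mem k hk)
    rwa [moduleIdeal, Ideal.map_span, ← Set.range_comp] at this
  eq k hk hkN := by rw [map_esymm, ht.eq k hk hkN, RingHom.comp_apply]

theorem zero (h : IsLambdaModule lam Lam) : IsModuleRoots f Lam 0 N 0 where
  mem k hk := by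
    obtain ⟨k, rfl⟩ : ∃ m, k = m + 1 := ⟨k - 1, by omega⟩
    rw [zero_esymm_succ]
    exact zero_mem _
  eq k hk _ := by
    rw [h.map_zero hk]
    obtain ⟨k, rfl⟩ : ∃ m, k = m + 1 := ⟨k - 1, by omega⟩
    rw [zero_esymm_succ, TrivSqZeroExt.inr_zero, _root_.map_zero]

theorem add (h : IsLambdaModule lam Lam) (ht : IsModuleRoots f Lam m N t)
    (ht' : IsModuleRoots f Lam n N t') : IsModuleRoots f Lam (m + n) N (t + t') where
  mem k hk := by
    rw [esymm_add_of_mul_eq_zero (ht.mul_eq_zero ht') hk]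
    exact add_mem (ht.mem k hk) (ht'.mem k hk)
  eq k hk hkN := by
    rw [esymm_add_of_mul_eq_zero (ht.mul_eq_zero ht') hk, ht.eq k hk hkN, ht'.eq k hk hkN,
      h.map_add k hk, TrivSqZeroExt.inr_add, map_add]

theorem sum (h : IsLambdaModule lam Lam) {ι : Type*} (S : Finset ι) {m : ι → M}
    {t : ι → Multiset B} (ht : ∀ i ∈ S, IsModuleRoots f Lam (m i) N (t i)) :
    IsModuleRoots f Lam (∑ i ∈ S, m i) N (∑ i ∈ S, t i) := by
  classical
  induction S using Finset.induction_on with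
  | empty => simpa using zero h
  | insert a S ha ih =>
    rw [Finset.sum_insert ha, Finset.sum_insert ha]
    exact add h (ht _ (Finset.mem_insert_self a S))
      (ih fun i hi => ht i (Finset.mem_insert_of_mem hi))

/-- The axiom `Λ^k(rm) = Ψ^k(r) Λ^k(m)` is the identity `e_k(s·t) = p_k(s) e_k(t)`. The factor
`p_k(s)` need not come from `R` when `k > N`, which is why membership refers to an ideal of `B`. -/
theorem smul (h : IsLambdaModule lam Lam) {r : R} {s : Multiset B}
    (hs : IsRoots (f.comp (TrivSqZeroExt.inlHom R M)) (lam · r) N s)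
    (ht : IsModuleRoots f Lam m N t) : IsModuleRoots f Lam (r • m) N (mulRoots s t) where
  mem k hk := by
    rw [ht.isNull.esymm_mulRoots s hk]
    exact Ideal.mul_mem_left _ _ (ht.mem k hk)
  eq k hk hkN := by
    rw [ht.isNull.esymm_mulRoots s hk, ht.eq k hk hkN, powerSum_eq_adams hs hk hkN,
      h.Lam_smul k hk, RingHom.comp_apply, ← map_mul, TrivSqZeroExt.inlHom_apply,
      TrivSqZeroExt.inl_mul_inr]

theorem ext (h : IsLambdaModule lam Lam) (ht : IsModuleRoots f Lam m N t) {k l : ℕ} (hl : 0 < l)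
    (hkl : k * l ≤ N) : IsModuleRoots f Lam (Lam l m) k (extRoots l t) where
  mem i hi := by
    rw [ht.isNull.esymm_extRoots hi hl]
    exact Ideal.mul_mem_left _ _ (ht.mem _ (Nat.mul_pos hi hl))
  eq i hi hik := by
    rw [ht.isNull.esymm_extRoots hi hl, ht.eq _ (Nat.mul_pos hi hl)
      ((Nat.mul_le_mul_right l hik).trans hkl), h.Lam_mul i l hi hl, TrivSqZeroExt.inr_smul,
      map_zsmul, zsmul_eq_mul]
    push_cast
    rw [← mul_assoc, ← mul_pow]
    simp

theorem add_of_esymm_eq_zero (ht : IsModuleRoots f Lam m N t)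
    (ht' : ∀ k, 0 < k → t'.esymm k = 0) : IsModuleRoots f Lam m N (t + t') := by
  have h : ∀ k, 0 < k → (t + t').esymm k = t.esymm k := fun k hk => by
    rw [esymm_add_of_mul_eq_zero (fun a b _ hb => by rw [ht' b hb, mul_zero]) hk, ht' k hk,
      add_zero]
  exact ⟨fun k hk => h k hk ▸ ht.mem k hk, fun k hk hkN => h k hk ▸ ht.eq k hk hkN⟩

theorem esymm_mulRoots_eq_zero (ht : IsModuleRoots f Lam m N t) (ht' : IsModuleRoots f Lam n N t')
    (k : ℕ) (hk : 0 < k) : (mulRoots t t').esymm k = 0 := by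
  rw [ht'.isNull.esymm_mulRoots t hk, ht.isNull.powerSum_eq hk, mul_assoc,
    ht.mul_eq_zero ht' k k hk hk, mul_zero]

end IsModuleRoots

/-! ### The operations of `R ⋊ M` expressed through formal roots -/

theorem semidirectLam_eq (h : IsPreLambdaRing lam) (i : ℕ) (x : TrivSqZeroExt R M) :
    semidirectLam lam Lam i x = TrivSqZeroExt.inl (lam i x.fst) +
      TrivSqZeroExt.inr (∑ j ∈ Finset.Icc 1 i, lam (i - j) x.fst • Lam j x.snd) := by
  rw [semidirectLam]
  split_ifs with hi
  · subst hi
    simp [h.lam_zero]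
  · rfl

theorem fst_semidirectLam (h : IsPreLambdaRing lam) (i : ℕ) (x : TrivSqZeroExt R M) :
    (semidirectLam lam Lam i x).fst = lam i x.fst := by
  simp [semidirectLam_eq h]

theorem snd_semidirectLam (h : IsPreLambdaRing lam) (i : ℕ) (x : TrivSqZeroExt R M) :
    (semidirectLam lam Lam i x).snd =
      ∑ j ∈ Finset.Icc 1 i, lam (i - j) x.fst • Lam j x.snd := by
  simp [semidirectLam_eq h]

/-- The operations on `(r, m)` are the coefficients of `λ_t(r) · (1 + ∑ Λ^j(m) t^j)`, and
multiplying series means uniting roots. -/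
theorem isRoots_semidirectLam (h : IsPreLambdaRing lam) {f : TrivSqZeroExt R M →+* B}
    {x : TrivSqZeroExt R M} {N : ℕ} {s t : Multiset B}
    (hs : IsRoots (f.comp (TrivSqZeroExt.inlHom R M)) (lam · x.fst) N s)
    (ht : IsModuleRoots f Lam x.snd N t) :
    IsRoots f (semidirectLam lam Lam · x) N (s + t) := fun k hk => by
  dsimp only
  rw [semidirectLam_eq h, esymm_add_eq_add_sum_Icc, map_add, hs k hk, RingHom.comp_apply,
    TrivSqZeroExt.inlHom_apply, TrivSqZeroExt.inr_sum, map_sum]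
  congr 1
  refine Finset.sum_congr rfl fun j hj => ?_
  have := Finset.mem_Icc.1 hj
  rw [hs _ (by omega), ht.eq _ (by omega) (by omega), RingHom.comp_apply,
    TrivSqZeroExt.inlHom_apply, ← map_mul, TrivSqZeroExt.inl_mul_inr]

/-- Formal roots for the two components of an element of `R ⋊ M`. -/
structure IsRootPair (lam : ℕ → R → R) (Lam : ℕ → M → M) (f : TrivSqZeroExt R M →+* B)
    (x : TrivSqZeroExt R M) (N : ℕ) (s t : Multiset B) : Prop where
  isRoots : IsRoots (f.comp (TrivSqZeroExt.inlHom R M)) (lam · x.fst) N s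
  isModuleRoots : IsModuleRoots f Lam x.snd N t

theorem exists_isRootPair.{u} {B : Type u} [CommRing B] (h : IsPreLambdaRing lam)
    (f : TrivSqZeroExt R M →+* B) (x : TrivSqZeroExt R M) (N : ℕ) :
    ∃ (C : Type u) (_ : CommRing C) (g : B →+* C) (s t : Multiset C),
      Function.Injective g ∧ IsRootPair lam Lam (g.comp f) x N s t := by
  obtain ⟨C, _, g, s, hg, -, hs⟩ := exists_roots
    (fun k => f (TrivSqZeroExt.inl (lam k x.fst)))
    (by rw [h.lam_zero, TrivSqZeroExt.inl_one, map_one]) N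
  obtain ⟨D, hD, g', t, hg', hcard, ht⟩ := exists_roots
    (fun k => if k = 0 then 1 else g (f (TrivSqZeroExt.inr (Lam k x.snd)))) (if_pos rfl) N
  have ht' : ∀ k, 0 < k → k ≤ N →
      t.esymm k = (g'.comp g).comp f (TrivSqZeroExt.inr (Lam k x.snd)) := fun k hk hkN => by
    rw [ht k hkN, if_neg hk.ne']
    rfl
  refine ⟨D, hD, g'.comp g, s.map g', t, hg'.comp hg, fun k hk => ?_, fun k hk => ?_, ht'⟩
  · rw [map_esymm, hs k hk]
    rfl
  -- Membership is needed in every positive degree. Beyond `N` it is automatic, since `t` has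
  -- exactly `N` elements.
  · rcases le_or_gt k N with hkN | hkN
    · rw [ht' k hk hkN]
      exact Ideal.subset_span ⟨_, rfl⟩
    · rw [esymm_eq_zero_of_card_lt t (hcard ▸ hkN)]
      exact zero_mem _

theorem IsRootPair.map {f : TrivSqZeroExt R M →+* B} {x : TrivSqZeroExt R M} {N : ℕ}
    {s t : Multiset B} (h : IsRootPair lam Lam f x N s t) (g : B →+* C) :
    IsRootPair lam Lam (g.comp f) x N (s.map g) (t.map g) :=
  ⟨h.isRoots.map g, h.isModuleRoots.map g⟩

theorem IsRootPair.isRoots_add {f : TrivSqZeroExt R M →+* B} {x : TrivSqZeroExt R M} {N : ℕ}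
    {s t : Multiset B} (h : IsRootPair lam Lam f x N s t) (hlam : IsPreLambdaRing lam) :
    IsRoots f (semidirectLam lam Lam · x) N (s + t) :=
  isRoots_semidirectLam hlam h.isRoots h.isModuleRoots

variable (M) in
theorem semidirectLam_one (hR : IsLambdaRing lam) (hM : IsLambdaModule lam Lam) (i : ℕ) :
    semidirectLam lam Lam i (1 : TrivSqZeroExt R M) = TrivSqZeroExt.inl (lam i 1) := by
  rw [semidirectLam_eq hR.toIsPreLambdaRing, Finset.sum_eq_zero]
  · simp
  · intro j hj
    rw [TrivSqZeroExt.snd_one, hM.map_zero (Finset.mem_Icc.1 hj).1, smul_zero]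

theorem isPreLambdaRing_semidirectLam (hR : IsLambdaRing lam) (hM : IsLambdaModule lam Lam) :
    IsPreLambdaRing (semidirectLam lam Lam : ℕ → TrivSqZeroExt R M → TrivSqZeroExt R M) where
  lam_zero x := if_pos rfl
  lam_one x := by
    rw [semidirectLam_eq hR.toIsPreLambdaRing]
    simp [hR.lam_zero, hR.lam_one, hM.Lam_one, TrivSqZeroExt.inl_fst_add_inr_snd_eq]
  lam_add i x y := by
    obtain ⟨B, _, f, s, t, hf, hx⟩ := exists_isRootPair (Lam := Lam) hR.toIsPreLambdaRing
      (RingHom.id (TrivSqZeroExt R M)) x i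
    obtain ⟨C, _, g, s', t', hg, hy⟩ := exists_isRootPair (Lam := Lam) hR.toIsPreLambdaRing
      (f.comp (RingHom.id (TrivSqZeroExt R M))) y i
    have hx := hx.map g
    have hxy := isRoots_semidirectLam (x := x + y) hR.toIsPreLambdaRing
      (hR.isRoots_add hx.isRoots hy.isRoots) (hx.isModuleRoots.add hM hy.isModuleRoots) i le_rfl
    apply hf
    apply hg
    change (g.comp (f.comp (RingHom.id _))) _ = (g.comp (f.comp (RingHom.id _))) _
    rw [← hxy, add_add_add_comm, esymm_add, map_sum]
    refine Finset.sum_congr rfl fun j hj => ?_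
    have := Finset.mem_range.1 hj
    rw [map_mul, hx.isRoots_add hR.toIsPreLambdaRing j (by omega),
      hy.isRoots_add hR.toIsPreLambdaRing _ (by omega)]

/-- If `R` is a λ-ring and `M` is a λ-module over `R`, then `R ⋊ M` is a λ-ring. -/
theorem isLambdaRing_semidirectLam (hR : IsLambdaRing lam) (hM : IsLambdaModule lam Lam) :
    IsLambdaRing (semidirectLam lam Lam : ℕ → TrivSqZeroExt R M → TrivSqZeroExt R M) where
  toIsPreLambdaRing := isPreLambdaRing_semidirectLam hR hM
  lamSeries_one := by
    ext1 i
    have h := congrArg (PowerSeries.coeff i) hR.lamSeries_one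
    rw [PowerSeries.coeff_mk] at h
    rw [PowerSeries.coeff_mk, semidirectLam_one M hR hM, h]
    simp only [_root_.map_add, PowerSeries.coeff_one, PowerSeries.coeff_X, TrivSqZeroExt.inl_add]
    split_ifs <;> simp
  lam_mul i x y := by
    obtain ⟨B, _, f, s, t, hf, hx⟩ := exists_isRootPair (Lam := Lam) hR.toIsPreLambdaRing
      (RingHom.id (TrivSqZeroExt R M)) x i
    obtain ⟨C, _, g, s', t', hg, hy⟩ := exists_isRootPair (Lam := Lam) hR.toIsPreLambdaRing
      (f.comp (RingHom.id (TrivSqZeroExt R M))) y i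
    have hx := hx.map g
    -- Expanding `(s + t)(s' + t')`, the two mixed products are roots for the two summands of the
    -- second component. The product of `t` and `t'` has no elementary symmetric functions in
    -- positive degree and may be added freely.
    have hmod : IsModuleRoots (g.comp (f.comp (RingHom.id _))) Lam (x * y).snd i
        (mulRoots s' (t.map g) + mulRoots (s.map g) t' + mulRoots (t.map g) t') := by
      rw [TrivSqZeroExt.snd_mul, op_smul_eq_smul, add_comm]
      exact ((hx.isModuleRoots.smul hM hy.isRoots).add hM
        (hy.isModuleRoots.smul hM hx.isRoots)).add_of_esymm_eq_zero
          (hx.isModuleRoots.esymm_mulRoots_eq_zero hy.isModuleRoots)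
    have hxy := isRoots_semidirectLam (x := x * y) hR.toIsPreLambdaRing
      (hR.isRoots_mul hx.isRoots hy.isRoots) hmod i le_rfl
    apply hf
    apply hg
    change (g.comp (f.comp (RingHom.id _))) _ = (g.comp (f.comp (RingHom.id _))) _
    rw [← hxy, map_aeval_prodPoly (hx.isRoots_add hR.toIsPreLambdaRing)
      (hy.isRoots_add hR.toIsPreLambdaRing) le_rfl, add_mulRoots, mulRoots_add, mulRoots_add,
      mulRoots_comm s']
    congr 1
    abel
  lam_lam i j x := by
    obtain ⟨B, _, f, s, t, hf, hx⟩ := exists_isRootPair (Lam := Lam) hR.toIsPreLambdaRing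
      (RingHom.id (TrivSqZeroExt R M)) x (i * j)
    have hfst : IsRoots ((f.comp (RingHom.id _)).comp (TrivSqZeroExt.inlHom R M))
        (lam · (semidirectLam lam Lam j x).fst) i (extRoots j s) := by
      rw [fst_semidirectLam hR.toIsPreLambdaRing]
      exact hR.isRoots_lam hx.isRoots le_rfl
    -- The part of `extRoots j (s + t)` using `l ≥ 1` elements of `t` gives roots for `λ^{j-l}(r)
    -- Λ^l(m)`; the part with `l = 0` is `extRoots j s`, which belongs to the first component.
    have hsnd : IsModuleRoots (f.comp (RingHom.id _)) Lam (semidirectLam lam Lam j x).snd i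
        (∑ l ∈ Finset.Icc 1 j, mulRoots (extRoots (j - l) s) (extRoots l t)) := by
      rw [snd_semidirectLam hR.toIsPreLambdaRing]
      refine IsModuleRoots.sum hM _ fun l hl => ?_
      obtain ⟨hl, hlj⟩ := Finset.mem_Icc.1 hl
      exact (hx.isModuleRoots.ext hM hl (Nat.mul_le_mul_left i hlj)).smul hM
        (hR.isRoots_lam hx.isRoots (Nat.mul_le_mul_left i (Nat.sub_le j l)))
    apply hf
    change (f.comp (RingHom.id _)) _ = (f.comp (RingHom.id _)) _
    rw [← isRoots_semidirectLam hR.toIsPreLambdaRing hfst hsnd i le_rfl,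
      map_aeval_compPoly (hx.isRoots_add hR.toIsPreLambdaRing) le_rfl, extRoots_add,
      Finset.sum_range_succ', add_comm, extRoots_zero, Nat.sub_zero, mulRoots_singleton,
      ← Finset.Ico_succ_right_eq_Icc, Finset.sum_Ico_eq_sum_range]
    simp [add_comm 1]

/-- The Adams operations of `R ⋊ M`. -/
theorem adams_semidirectLam (hR : IsPreLambdaRing lam) {i : ℕ} (hi : 0 < i)
    (x : TrivSqZeroExt R M) :
    adams (semidirectLam lam Lam) i x = semidirectPsi (adams lam) (adamsModule Lam) i x := by
  obtain ⟨B, _, f, s, t, hf, hx⟩ := exists_isRootPair (Lam := Lam) hR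
    (RingHom.id (TrivSqZeroExt R M)) x i
  apply hf
  change (f.comp (RingHom.id _)) _ = (f.comp (RingHom.id _)) _
  rw [← powerSum_eq_adams (hx.isRoots_add hR) hi le_rfl, powerSum_add,
    powerSum_eq_adams hx.isRoots hi le_rfl, hx.isModuleRoots.isNull.powerSum_eq hi,
    hx.isModuleRoots.eq i hi le_rfl, semidirectPsi, map_add, adamsModule, TrivSqZeroExt.inr_smul,
    map_zsmul, zsmul_eq_mul]
  push_cast
  rfl

theorem isPsiModule_adamsModule (hM : IsLambdaModule lam Lam) :
    IsPsiModule (adams lam) (adamsModule Lam) where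
  map_add i hi m n := by rw [adamsModule, hM.map_add i hi, smul_add]; rfl
  psi_one m := by simp [adamsModule, hM.Lam_one]
  psi_smul i hi r m := by rw [adamsModule, hM.Lam_smul i hi, smul_comm]; rfl
  psi_psi i j hi hj m := by
    have hz : ∀ (z : ℤ) (m : M), Lam i (z • m) = z • Lam i m := fun z m =>
      map_zsmul (AddMonoidHom.mk' (Lam i) (hM.map_add i hi)) z m
    rw [adamsModule, adamsModule, adamsModule, hz, hM.Lam_mul i j hi hj, smul_smul, smul_smul,
      ← neg_one_pow_sign]
    congr 1
    have hsq : (-1 : ℤ) ^ (i * j + 1) * (-1) ^ (i * j + 1) = 1 := by rw [← mul_pow]; simp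
    push_cast
    linear_combination (-(-1) ^ (i + 1) * (-1) ^ (j + 1) * i * j) * hsq

end Semidirect

end LambdaPsi

theorem mainTheorem10 {R M : Type*} [CommRing R] [AddCommGroup M] [Module R M]
    [Module Rᵐᵒᵖ M] [IsCentralScalar R M]
    (lam : ℕ → R → R) (Lam : ℕ → M → M)
    (hR : LambdaPsi.IsLambdaRing lam) (hM : LambdaPsi.IsLambdaModule lam Lam) :
    LambdaPsi.IsLambdaRing (LambdaPsi.semidirectLam lam Lam) ∧
    LambdaPsi.IsPsiRing (LambdaPsi.adams lam) ∧
    LambdaPsi.IsPsiModule (LambdaPsi.adams lam) (LambdaPsi.adamsModule Lam) ∧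
    LambdaPsi.IsPsiRing
      (LambdaPsi.semidirectPsi (LambdaPsi.adams lam) (LambdaPsi.adamsModule Lam)) ∧
    ∀ i : ℕ, 0 < i → ∀ x : TrivSqZeroExt R M,
      LambdaPsi.adams (LambdaPsi.semidirectLam lam Lam) i x =
        LambdaPsi.semidirectPsi (LambdaPsi.adams lam) (LambdaPsi.adamsModule Lam) i x := by
  have hRM := LambdaPsi.isLambdaRing_semidirectLam hR hM
  have hA : ∀ i : ℕ, 0 < i → ∀ x : TrivSqZeroExt R M, _ = _ := fun i hi x =>
    LambdaPsi.adams_semidirectLam (Lam := Lam) hR.toIsPreLambdaRing hi x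
  have hP := hRM.isPsiRing_adams
  refine ⟨hRM, hR.isPsiRing_adams, LambdaPsi.isPsiModule_adamsModule hM,
    ?_, hA⟩
  -- Since the maps `semidirectPsi` are the Adams operations of the λ-ring `R ⋊ M`, the Ψ-ring
  -- axioms are inherited from the general result for λ-rings.
  constructor
  · intro i hi
    rw [← hA i hi, hP.map_one i hi]
  · intro i hi r s
    rw [← hA i hi, ← hA i hi, ← hA i hi, hP.map_add i hi]
  · intro i hi r s
    rw [← hA i hi, ← hA i hi, ← hA i hi, hP.map_mul i hi]
  · intro r
    rw [← hA 1 one_pos, hP.psi_one]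
  · intro i j hi hj r
    rw [← hA j hj, ← hA i hi, ← hA _ (Nat.mul_pos hi hj), hP.psi_psi i j hi hj]
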